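/- **Setting.** Let $\mathcal X,\Xi$ be Polish spaces, $\varpi\in\mathcal X$ an isolated point, and let $S^{\sqcup}(\mathcal Z)=\bigsqcup_{n\ge 0}\mathcal Z^n/\mathfrak S_n$ be the space of finite unordered sequences in $\mathcal Z$ with the disjoint union topology; $\langle z_A\rangle$ is the unordered sequence $(z_a)_{a\in A}$. Let $\mathbb V=\{\text{ø}\}\cup\bigcup_{k\ge1}\mathbb N^k$ be the Ulam–Harris labels, $\mathbb V^0=\mathbb V\setminus\{\text{ø}\}$, $\mathbb V_n$ the labels of length at most $n$, $\pi_v$ the parent of $v\in\mathbb V^0$, $\mathbb V_{v+}$ the set of strict descendants of $v$, and $\mathbb V_{v-}=\mathbb V\setminus(\mathbb V_{v+}\cup\{v,\pi_v\})$. For a tree $\mathcal T\subset\mathbb V$, $N_v(\mathcal T)$ is the set of neighbors of $v$ in $\mathcal T$ if $v\in\mathcal T$, and $N_v(\mathcal T)=\emptyset$ otherwise. Write $x[k]=(x(0),\dots,x(k))$. **Assumptions.** Let $\rho_{\text{ø}},\rho$ be probability measures on $\mathbb N_0$. Let $\mathcal T\sim\mathrm{GW}(\rho_{\text{ø}},\rho)$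 (independent offspring numbers, with law $\rho_{\text{ø}}$ at the root and $\rho$ elsewhere), and let $X_v(0)$, $v\in\mathbb V$, be $\mathcal X$-valued. With $Y_v(0)=(1_{\{v\in\mathcal T\}},X_v(0))$ assume: 1. for all $v\in\mathbb V^0$, $(Y_u(0))_{u\in\mathbb V_{v+}}$ and $(Y_u(0))_{u\in\mathbb V_{v-}}$ are conditionally independent given $(Y_v(0),Y_{\pi_v}(0))$; and there is one kernel that is, for every $v\in\mathbb V^0$, a version of the conditional law of $(Y_{vu}(0))_{u\in\mathbb V^0}$ given $(Y_v(0),Y_{\pi_v}(0))$; 2. the $\Xi$-valued noises $\xi_v(k)$, $v\in\mathbb V$, $k\ge1$, are i.i.d.; 3. they are independent of $(\mathcal T,(X_v(0))_{v\in\mathbb V})$; 4. the maps $F^k:\mathcal X^{k+1}\times S^{\sqcup}(\mathcal X^{k+1})\times\Xi\to\mathcal X\setminus\{\varpi\}$, $k\ge 0$, are measurable; 5. for each $v\in\mathbb V$, almost surely $X_v(0)=\varpi$ if and only if $v\notin\mathcal T$. Let $X_v(k+1)=F^k(X_v[k],\langle X_{N_v(\mathcal T)}[k]\rangle,\xi_v(k+1))$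 if $v\in\mathcal T$, and $X_v(k+1)=\varpi$ otherwise. **Local-field processes.** A local-field process $(\bar{\mathcal T},\bar X)$ with kernels $\bar\gamma=(\bar\gamma[k])_{k\ge0}$, on some probability space, consists of a random set $\bar{\mathcal T}\subset\mathbb V$ and an $\mathcal X^{\mathbb V_2}$-valued process $\bar X$ such that $(\bar{\mathcal T},\bar X(0))$ has the law of $(\mathcal T\cap\mathbb V_2,(X_v(0))_{v\in\mathbb V_2})$ and, for each $k\ge0$: * $\bar\gamma[k](\cdot\,|\,x_1,x_{\text{ø}})$ is a version of the conditional law of $\langle\bar X_{N_1(\bar{\mathcal T})}[k]\rangle$ given $\bar X_1[k]=x_1$, $\bar X_{\text{ø}}[k]=x_{\text{ø}}$; * there are phantom particles $\bar Z^k_v\in S^{\sqcup}(\mathcal X^{k+1})$, $v\in\bar{\mathcal T}\cap(\mathbb V_2\setminus\mathbb V_1)$, that are conditionally independent given $(\bar{\mathcal T},\bar X[k])$ with $\bar Z^k_v\sim\bar\gamma[k](\cdot\,|\,\bar X_v[k],\bar X_{\pi_v}[k])$; * there are i.i.d. noises $\bar\xi_v(k+1)$, $v\in\mathbb V_2$,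 with the law of the $\xi_v(k)$, independent of $(\bar{\mathcal T},\bar X[k],\bar Z^k)$; * for $v\in\bar{\mathcal T}$, $\bar X_v(k+1)=F^k(\bar X_v[k],\langle\bar X_{N_v(\bar{\mathcal T})}[k]\rangle,\bar\xi_v(k+1))$ if $v\in\mathbb V_1$, and $\bar X_v(k+1)=F^k(\bar X_v[k],\bar Z^k_v,\bar\xi_v(k+1))$ if $v\in\mathbb V_2\setminus\mathbb V_1$; for $v\in\mathbb V_2\setminus\bar{\mathcal T}$, $\bar X_v(k+1)=\varpi$. **Theorem.** (a) There are kernels $\gamma[k]$, $k\ge0$, such that for every $v\in\mathbb V^0$ simultaneously $\gamma[k]$ is a version of the conditional law of $\langle X_{N_v(\mathcal T)}[k]\rangle$ given $(X_v[k],X_{\pi_v}[k])$. (b) For any kernels as in (a), a local-field process with $\bar\gamma=\gamma$ exists, and for every such process $$(1_{\{v\in\mathcal T\}},X_v)_{v\in\mathbb V_2}\overset{d}{=}(1_{\{v\in\bar{\mathcal T}\}},\bar X_v)_{v\in\mathbb V_2}$$ as $(\{0,1\}\times\mathcal X^\infty)^{\mathbb V_2}$-valued random variables. (c) The same equality in law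 holds for every local-field process, with any kernels $\bar\gamma[k]$, for which the choice of the versions is immaterial, in the sense that for all $k\ge0$ and $v\in\mathbb V_2\setminus\mathbb V_1$ the law of $(\bar X_v[k],\bar X_{\pi_v}[k])$ restricted to the event $\{v\in\bar{\mathcal T}\}$ is absolutely continuous with respect to the law of $(\bar X_1[k],\bar X_{\text{ø}}[k])$. -/

import Mathlib

open MeasureTheory ProbabilityTheory
open scoped ENNReal

universe u w

namespace LocalField

/-! ### Finite unordered sequences -/

/-- The space of finite unordered `Z`-valued sequences of arbitrary (possibly zero) length,
that is, the disjoint union over `n` of the quotients of `Z ^ n` by permutations: an element is a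
finite multiset. -/
def UnorderedSeq (Z : Type*) : Type _ := Multiset Z

/-- The canonical map from ordered `n`-tuples to unordered sequences. -/
def UnorderedSeq.ofTuple {Z : Type*} (n : ℕ) (z : Fin n → Z) : UnorderedSeq Z :=
  (Multiset.ofList (List.ofFn z) : Multiset Z)

/-- The disjoint union topology of the quotient topologies, that is, the finest topology for which
all the canonical maps `Z ^ n → UnorderedSeq Z` are continuous. -/
instance UnorderedSeq.instTopologicalSpace (Z : Type*) [TopologicalSpace Z] :
    TopologicalSpace (UnorderedSeq Z) :=
  ⨆ n : ℕ, TopologicalSpace.coinduced (UnorderedSeq.ofTuple (Z := Z) n) inferInstance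

instance UnorderedSeq.instMeasurableSpace (Z : Type*) [TopologicalSpace Z] :
    MeasurableSpace (UnorderedSeq Z) := borel _

instance UnorderedSeq.instBorelSpace (Z : Type*) [TopologicalSpace Z] :
    BorelSpace (UnorderedSeq Z) := ⟨rfl⟩

open Classical in
/-- The unordered sequence `⟨z_A⟩ = ⟨(z_a)_{a ∈ A}⟩` for a finite index set `A` (repeated values
are kept). The value for infinite `A` is irrelevant: it only occurs on null sets. -/
noncomputable def unordered {ι Z : Type*} (z : ι → Z) (A : Set ι) : UnorderedSeq Z :=
  if h : A.Finite then (h.toFinset.val.map z : Multiset Z) else (0 : Multiset Z)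

/-! ### Ulam-Harris-Neveu labels and trees -/

/-- The set of labels `{ø} ∪ ⋃ k ≥ 1, ℕ ^ k` with `ℕ = {1, 2, …}`. The root is `[]`, concatenation
is `++`, and the parent of `v ≠ []` is `v.dropLast`. -/
abbrev Label : Type := List ℕ+

/-- The labels other than the root. -/
abbrev NonRoot : Type := {v : Label // v ≠ []}

/-- The labels of generations `0`, `1`, `2`. -/
abbrev Label2 : Type := {v : Label // v.length ≤ 2}

/-- The set of labels of generations `0`, `1`, `2`. -/
def firstTwoGenerations : Set Label := {v | v.length ≤ 2}

/-- The root as an element of `Label2`. -/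
def root2 : Label2 := ⟨[], by simp⟩

/-- The label `1` (first child of the root) as an element of `Label2`. -/
def one2 : Label2 := ⟨[1], by simp⟩

/-- The parent of a label in `Label2` (used for non-root labels only). -/
def parent2 (v : Label2) : Label2 := ⟨v.1.dropLast, by
  have h := v.2
  simp only [List.length_dropLast]
  omega⟩

/-- The labels strictly below `v`. -/
def below (v : Label) : Set Label := {u | v <+: u ∧ u ≠ v}

/-- The labels on the other side of the edge between `v` and its parent, that is, those that are
neither strictly below `v` nor equal to `v` or its parent. -/
def beyond (v : Label) : Set Label := {u | u ∉ below v ∧ u ≠ v ∧ u ≠ v.dropLast}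

/-- The set of neighbors of `v` in the tree `T`: the members of `T` that are the parent of `v` or
a child of `v`, if `v ∈ T`; the empty set if `v ∉ T`. -/
def nbrs (T : Set Label) (v : Label) : Set Label :=
  {u | u ∈ T ∧ v ∈ T ∧ ((∃ k : ℕ+, v = u ++ [k]) ∨ (∃ k : ℕ+, u = v ++ [k]))}

/-- The tree in which every vertex `u` has exactly the children `u1, …, u(c u)`. -/
def treeOfCounts (c : Label → ℕ) : Set Label :=
  {v | ∀ (u : Label) (k : ℕ+), (u ++ [k]) <+: v → (k : ℕ) ≤ c u}

open Classical in
/-- The offspring law at the vertex `v`: `ρ₀` at the root and `ρ` elsewhere. -/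
noncomputable def offspringLaw (ρ₀ ρ : Measure ℕ) (v : Label) : Measure ℕ :=
  if v = [] then ρ₀ else ρ

instance offspringLaw.instIsProbabilityMeasure (ρ₀ ρ : Measure ℕ) [IsProbabilityMeasure ρ₀]
    [IsProbabilityMeasure ρ] (v : Label) : IsProbabilityMeasure (offspringLaw ρ₀ ρ v) := by
  unfold offspringLaw
  split_ifs <;> infer_instance

/-- The law `GW(ρ₀, ρ)` of the Galton-Watson tree: the offspring numbers of the vertices are
independent, with law `ρ₀` at the root and law `ρ` at all the other vertices. Sets of labels carry
the product σ-algebra of `{0,1} ^ Label`. -/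
noncomputable def gwLaw (ρ₀ ρ : Measure ℕ) [IsProbabilityMeasure ρ₀] [IsProbabilityMeasure ρ] :
    Measure (Set Label) :=
  (Measure.infinitePi (offspringLaw ρ₀ ρ)).map treeOfCounts

/-! ### Conditional laws and conditional independence -/

/-- The kernel `κ` is a version of the regular conditional law of `Z` given `W` under `μ`. -/
def IsCondLaw {Ω 𝓦 𝓩 : Type*} [MeasurableSpace Ω] [MeasurableSpace 𝓦] [MeasurableSpace 𝓩]
    (μ : Measure Ω) (W : Ω → 𝓦) (Z : Ω → 𝓩) (κ : Kernel 𝓦 𝓩) : Prop :=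
  IsMarkovKernel κ ∧ (μ.map W) ⊗ₘ κ = μ.map (fun ω => (W ω, Z ω))

/-- `f` and `g` are conditionally independent given `h` under `μ`. -/
def CondIndepGiven {Ω 𝓐 𝓑 𝓒 : Type*} [MeasurableSpace Ω] [MeasurableSpace 𝓐] [MeasurableSpace 𝓑]
    [m𝓒 : MeasurableSpace 𝓒] (μ : Measure Ω) (f : Ω → 𝓐) (g : Ω → 𝓑) (h : Ω → 𝓒) : Prop :=
  ∀ (A : Set 𝓐) (B : Set 𝓑), MeasurableSet A → MeasurableSet B →
    condExp (m𝓒.comap h) μ ((f ⁻¹' A ∩ g ⁻¹' B).indicator (fun _ => (1 : ℝ))) =ᵐ[μ]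
      fun ω => condExp (m𝓒.comap h) μ ((f ⁻¹' A).indicator (fun _ => (1 : ℝ))) ω *
        condExp (m𝓒.comap h) μ ((g ⁻¹' B).indicator (fun _ => (1 : ℝ))) ω

/-! ### The particle system on the Galton-Watson tree -/

/-- The history `x[k] = (x(0), …, x(k))` of a process with values in `𝓧`. -/
def hist {Ω 𝓧 : Type*} (x : ℕ → Ω → 𝓧) (k : ℕ) (ω : Ω) : Fin (k + 1) → 𝓧 :=
  fun i => x i ω

/-- The marked state `Y_v(0) = (1_{v ∈ T}, X_v(0))`; propositions play the role of `{0,1}`. -/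
def marked {Ω 𝓧 : Type*} (T : Ω → Set Label) (X : Label → ℕ → Ω → 𝓧) (v : Label) (ω : Ω) :
    Prop × 𝓧 :=
  (v ∈ T ω, X v 0 ω)

/-- Update functions: for every `k` a map `F k` from (own history, unordered sequence of the
neighbors' histories, noise) to a new state. -/
abbrev Update (𝓧 Ξ : Type*) : Type _ :=
  ∀ k : ℕ, (Fin (k + 1) → 𝓧) → UnorderedSeq (Fin (k + 1) → 𝓧) → Ξ → 𝓧

/-- The standing assumptions on the tree `T`, the initial states `X_v(0)`, the noises and the update
functions. Here `ξ v k` denotes the noise `ξ_v(k+1)` that drives the step of `v` from time `k` to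
time `k + 1`, and `ν` is the common law of the noises. -/
structure GWAssumptions {Ω 𝓧 Ξ : Type*} [MeasurableSpace Ω] [TopologicalSpace 𝓧]
    [MeasurableSpace 𝓧] [MeasurableSpace Ξ] (ρ₀ ρ : Measure ℕ) [IsProbabilityMeasure ρ₀]
    [IsProbabilityMeasure ρ] (ϖ : 𝓧) (F : Update 𝓧 Ξ) (ν : Measure Ξ) (μ : Measure Ω)
    (T : Ω → Set Label) (X : Label → ℕ → Ω → 𝓧) (ξ : Label → ℕ → Ω → Ξ) : Prop where
  measurable_tree : Measurable T
  measurable_init : ∀ v, Measurable (X v 0)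
  measurable_noise : ∀ v k, Measurable (ξ v k)
  law_tree : μ.map T = gwLaw ρ₀ ρ
  condIndep_init : ∀ v : Label, v ≠ [] →
    CondIndepGiven μ (fun ω (u : below v) => marked T X u ω)
      (fun ω (u : beyond v) => marked T X u ω)
      (fun ω => (marked T X v ω, marked T X v.dropLast ω))
  /-- The conditional law of `(Y_{vu}(0))_{u ≠ ø}` given `(Y_v(0), Y_{π_v}(0))` does not depend on
  the choice of `v ≠ ø`: some kernel is a version of it for all `v`. -/
  homogeneous_init : ∃ Θ : Kernel ((Prop × 𝓧) × (Prop × 𝓧)) (NonRoot → Prop × 𝓧),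
    ∀ v : Label, v ≠ [] →
      IsCondLaw μ (fun ω => (marked T X v ω, marked T X v.dropLast ω))
        (fun ω (u : NonRoot) => marked T X (v ++ u.1) ω) Θ
  noise_indep : iIndepFun (fun (p : Label × ℕ) => ξ p.1 p.2) μ
  noise_law : ∀ v k, μ.map (ξ v k) = ν
  indep_init_noise : IndepFun (fun ω => (T ω, fun v => X v 0 ω))
    (fun ω (p : Label × ℕ) => ξ p.1 p.2 ω) μ
  measurable_update : ∀ k, Measurable (fun p : (Fin (k + 1) → 𝓧) ×
    UnorderedSeq (Fin (k + 1) → 𝓧) × Ξ => F k p.1 p.2.1 p.2.2)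
  update_ne_cemetery : ∀ k x z e, F k x z e ≠ ϖ
  cemetery_init : ∀ v, ∀ᵐ ω ∂μ, X v 0 ω = ϖ ↔ v ∉ T ω

open Classical in
/-- The dynamics
`X_v(k+1) = 1_{v ∈ T} F^k(X_v[k], ⟨X_{N_v(T)}[k]⟩, ξ_v(k+1))`, where `0 x = ϖ`. -/
def GWDynamics {Ω 𝓧 Ξ : Type*} [MeasurableSpace Ω] [MeasurableSpace 𝓧] (ϖ : 𝓧)
    (F : Update 𝓧 Ξ) (μ : Measure Ω) (T : Ω → Set Label) (X : Label → ℕ → Ω → 𝓧)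
    (ξ : Label → ℕ → Ω → Ξ) : Prop :=
  (∀ v k, Measurable (X v k)) ∧
  ∀ v k, ∀ᵐ ω ∂μ, X v (k + 1) ω =
    if v ∈ T ω then
      F k (hist (X v) k ω) (unordered (fun u => hist (X u) k ω) (nbrs (T ω) v)) (ξ v k ω)
    else ϖ

/-! ### The local-field process -/

/-- The unordered sequence `⟨X̄_{N_v(T̄)}[k]⟩` of the histories of the neighbors of `v`, for `v` in
generation `0` or `1`, so that all neighbors of `v` belong to the first two generations. -/
noncomputable def nbrHist2 {Ω 𝓧 : Type*} (T : Ω → Set Label) (X : Label2 → ℕ → Ω → 𝓧)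
    (v : Label2) (k : ℕ) (ω : Ω) : UnorderedSeq (Fin (k + 1) → 𝓧) :=
  unordered (fun u : Label2 => hist (X u) k ω) {u : Label2 | u.1 ∈ nbrs (T ω) v.1}

open Classical in
/-- `(T', X')`, on a probability space with measure `P`, is a local-field process with noises `ξ'`
and phantom particles `Z`, where `γ k` is the version used of the conditional law of
`⟨X'_{N_1}[k]⟩` given `(X'_1[k], X'_ø[k])`. The initial law is `μ₀`, and `ν` is the law of the
noises; `ξ' v k` drives the step from time `k` to time `k + 1`. Only the variables `Z k v` with `v`
in generation two play a role, and only on the event `v ∈ T'`. -/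
structure IsLocalFieldProcess {Ω' 𝓧 Ξ : Type*} [MeasurableSpace Ω'] [TopologicalSpace 𝓧]
    [MeasurableSpace 𝓧] [MeasurableSpace Ξ] (ϖ : 𝓧) (F : Update 𝓧 Ξ) (ν : Measure Ξ)
    (μ₀ : Measure (Set Label × (Label2 → 𝓧)))
    (γ : ∀ k : ℕ, Kernel ((Fin (k + 1) → 𝓧) × (Fin (k + 1) → 𝓧))
      (UnorderedSeq (Fin (k + 1) → 𝓧)))
    (P : Measure Ω') (T' : Ω' → Set Label) (X' : Label2 → ℕ → Ω' → 𝓧)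
    (ξ' : Label2 → ℕ → Ω' → Ξ)
    (Z : ∀ k : ℕ, {v : Label2 // v.1.length = 2} → Ω' → UnorderedSeq (Fin (k + 1) → 𝓧)) :
    Prop where
  measurable_tree : Measurable T'
  measurable_state : ∀ v k, Measurable (X' v k)
  measurable_noise : ∀ v k, Measurable (ξ' v k)
  measurable_phantom : ∀ k v, Measurable (Z k v)
  init_law : P.map (fun ω => (T' ω, fun v => X' v 0 ω)) = μ₀
  /-- `γ k` is a version of the conditional law of `⟨X'_{N_1}[k]⟩` given
  `(X'_1[k], X'_ø[k])`. -/
  kernel_spec : ∀ k, IsCondLaw P (fun ω => (hist (X' one2) k ω, hist (X' root2) k ω))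
    (nbrHist2 T' X' one2 k) (γ k)
  noise_indep : ∀ k, iIndepFun (fun v => ξ' v k) P
  noise_law : ∀ v k, P.map (ξ' v k) = ν
  /-- The noises of a step are generated independently of the tree, the histories and the phantom
  particles that enter this step. -/
  noise_fresh : ∀ k, IndepFun
    (fun ω => ((T' ω, fun v => hist (X' v) k ω), fun v => Z k v ω)) (fun ω v => ξ' v k ω) P
  /-- Given the tree and the histories, the phantom particles `Z k v`, for `v` in the tree and in
  generation two, are conditionally independent with laws `γ k (X'_v[k], X'_{π_v}[k])`. -/
  phantom_law : ∀ (k : ℕ) (U : Finset {v : Label2 // v.1.length = 2})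
    (B : {v : Label2 // v.1.length = 2} → Set (UnorderedSeq (Fin (k + 1) → 𝓧))),
    (∀ v, MeasurableSet (B v)) →
    condExp (MeasurableSpace.comap (fun ω => (T' ω, fun v => hist (X' v) k ω)) inferInstance) P
        ({ω | ∀ v ∈ U, v.1.1 ∈ T' ω → Z k v ω ∈ B v}.indicator (fun _ => (1 : ℝ))) =ᵐ[P]
      fun ω => ∏ v ∈ U, if v.1.1 ∈ T' ω then
        (γ k (hist (X' v.1) k ω, hist (X' (parent2 v.1)) k ω)).real (B v) else 1
  /-- The update of the root and of the first generation. -/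
  step_inner : ∀ (v : Label2) (k : ℕ), v.1.length ≤ 1 → ∀ᵐ ω ∂P, X' v (k + 1) ω =
    if v.1 ∈ T' ω then F k (hist (X' v) k ω) (nbrHist2 T' X' v k ω) (ξ' v k ω) else ϖ
  /-- The update of the second generation, where phantom particles replace the neighbors. -/
  step_outer : ∀ (v : {v : Label2 // v.1.length = 2}) (k : ℕ), ∀ᵐ ω ∂P, X' v.1 (k + 1) ω =
    if v.1.1 ∈ T' ω then F k (hist (X' v.1) k ω) (Z k v ω) (ξ' v.1 k ω) else ϖ

/-- `γ k` is, for all non-root labels `v` simultaneously, a version of the conditional law of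
`⟨X_{N_v(T)}[k]⟩` given `(X_v[k], X_{π_v}[k])`. -/
def IsHomogeneousVersion {Ω 𝓧 : Type*} [MeasurableSpace Ω] [TopologicalSpace 𝓧]
    [MeasurableSpace 𝓧] (μ : Measure Ω) (T : Ω → Set Label) (X : Label → ℕ → Ω → 𝓧)
    (γ : ∀ k : ℕ, Kernel ((Fin (k + 1) → 𝓧) × (Fin (k + 1) → 𝓧))
      (UnorderedSeq (Fin (k + 1) → 𝓧))) : Prop :=
  ∀ (k : ℕ) (v : Label), v ≠ [] →
    IsCondLaw μ (fun ω => (hist (X v) k ω, hist (X v.dropLast) k ω))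
      (fun ω => unordered (fun u => hist (X u) k ω) (nbrs (T ω) v)) (γ k)

/-- The conditional laws `γ k` given `(X'_1[k], X'_ø[k])`, which are unique only almost everywhere
for the law of this pair, are determined by this at the points `(X'_v[k], X'_{π_v}[k])`, for `v` in
the tree and in generation two, at which the local-field process evaluates them. -/
def Unambiguous {Ω' 𝓧 : Type*} [MeasurableSpace Ω'] [MeasurableSpace 𝓧]
    (P : Measure Ω') (T' : Ω' → Set Label) (X' : Label2 → ℕ → Ω' → 𝓧) : Prop :=
  ∀ (k : ℕ) (v : Label2), v.1.length = 2 →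
    (P.restrict {ω | v.1 ∈ T' ω}).map (fun ω => (hist (X' v) k ω, hist (X' (parent2 v)) k ω)) ≪
      P.map (fun ω => (hist (X' one2) k ω, hist (X' root2) k ω))

/-- The law of `(T ∩ V₂, X_{V₂}(0))`, where `V₂` denotes the labels of the first two
generations. -/
noncomputable def initLaw2 {Ω 𝓧 : Type*} [MeasurableSpace Ω] [MeasurableSpace 𝓧]
    (μ : Measure Ω) (T : Ω → Set Label) (X : Label → ℕ → Ω → 𝓧) :
    Measure (Set Label × (Label2 → 𝓧)) :=
  μ.map (fun ω => (T ω ∩ firstTwoGenerations, fun v : Label2 => X v.1 0 ω))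

/-- The law of `(1_{v ∈ T}, X_v)_{v ∈ V₂}`, where `X_v` is the whole trajectory; propositions play
the role of `{0,1}`. -/
noncomputable def trajLaw2 {Ω 𝓧 : Type*} [MeasurableSpace Ω] [MeasurableSpace 𝓧]
    (μ : Measure Ω) (T : Ω → Set Label) (X : Label2 → ℕ → Ω → 𝓧) :
    Measure (Label2 → Prop × (ℕ → 𝓧)) :=
  μ.map (fun ω v => (v.1 ∈ T ω, fun k => X v k ω))

end LocalField

namespace LocalField

/-! ### Calculus of conditional laws -/

section CondLaw

variable {Ω 𝓒 𝓓 𝓔 𝓦 𝓥 : Type*} [MeasurableSpace Ω] [MeasurableSpace 𝓒] [MeasurableSpace 𝓓]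
  [MeasurableSpace 𝓔] [MeasurableSpace 𝓦] [MeasurableSpace 𝓥] {μ : Measure Ω}

/-! The cone at v consists of v and its descendants; the edge of v is the pair of v and its parent.
The engine of the proof is a Markov property of the histories, `IsConeMarkov`: given the histories
up to time k of all labels not strictly below v, those strictly below v have a law that depends on
the edge histories only, through a kernel common to all v. At time 0 this comes from the first
assumption, because the marks are almost surely functions of the states.

One step preserves the property (`IsConeMarkov.step`). The new states in the cone are a fixed map of
the old histories on the cone and its parent and of the noise in the cone. The new states outside
use only old histories that are not strictly below v, and the remaining noise, which is independent.
Given the outside, the new state of v and the new histories below it therefore have a joint law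
governed by the old edge; disintegrating this law moves the new state of v into the condition.

The neighborhood of v is a function of the edge and of the states strictly below v. So it has a
conditional law given the edge that is common to all v, which is (a), and further conditioning on
everything not strictly below v does not change it. Treating the vertices of generation two one
after another shows that their neighborhoods are conditionally independent given the first two
generations (`GWDynamics.lintegral_prod_nbhdIndicator`). Hence the restricted particle system, with
the true neighborhoods as phantom particles, is a local-field process
(`GWDynamics.isLocalFieldProcess`).

Conversely, the law of the tree and the histories up to time k, and the kernels at the points where
they are evaluated, determine the law at time k + 1 (`IsLocalFieldProcess.map_treeHist_eq`). With a
common kernel this is uniqueness in (b). In (c) the kernels may differ, but once the laws agree up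
to time k, both kernels are versions of one conditional law given the edge of the label 1; they
agree almost everywhere there, and absolute continuity carries this to the edges of generation two
(`IsLocalFieldProcess.ae_kernel_eq`). -/

theorem IsCondLaw.lintegral_eq [SFinite μ] {C : Ω → 𝓒} {D : Ω → 𝓓} {κ : Kernel 𝓒 𝓓}
    (h : IsCondLaw μ C D κ) (hC : Measurable C) (hD : Measurable D) {f : 𝓒 × 𝓓 → ℝ≥0∞}
    (hf : Measurable f) :
    ∫⁻ ω, f (C ω, D ω) ∂μ = ∫⁻ ω, ∫⁻ d, f (C ω, d) ∂κ (C ω) ∂μ := by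
  have := h.1
  rw [← lintegral_map hf (hC.prodMk hD), ← h.2, Measure.lintegral_compProd hf,
    lintegral_map hf.lintegral_kernel_prod_right' hC]

theorem isCondLaw_of_lintegral [SFinite μ] {C : Ω → 𝓒} {D : Ω → 𝓓} {κ : Kernel 𝓒 𝓓}
    [IsMarkovKernel κ] (hC : Measurable C) (hD : Measurable D)
    (h : ∀ f : 𝓒 × 𝓓 → ℝ≥0∞, Measurable f →
      ∫⁻ ω, f (C ω, D ω) ∂μ = ∫⁻ ω, ∫⁻ d, f (C ω, d) ∂κ (C ω) ∂μ) :
    IsCondLaw μ C D κ := by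
  refine ⟨inferInstance, Measure.ext_of_lintegral _ fun f hf => ?_⟩
  rw [lintegral_map hf (hC.prodMk hD), h f hf, Measure.lintegral_compProd hf,
    lintegral_map hf.lintegral_kernel_prod_right' hC]

theorem IsCondLaw.congr {C C' : Ω → 𝓒} {D D' : Ω → 𝓓} {κ : Kernel 𝓒 𝓓}
    (h : IsCondLaw μ C D κ) (hC : C =ᵐ[μ] C') (hD : D =ᵐ[μ] D') : IsCondLaw μ C' D' κ := by
  refine ⟨h.1, ?_⟩
  rw [← Measure.map_congr hC, h.2]
  exact Measure.map_congr (hC.prodMk hD)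

/-- Two versions of a conditional law agree almost everywhere on each event. -/
theorem IsCondLaw.ae_apply_eq [IsFiniteMeasure μ] {C : Ω → 𝓒} {D : Ω → 𝓓} {κ κ' : Kernel 𝓒 𝓓}
    (h : IsCondLaw μ C D κ) (h' : IsCondLaw μ C D κ') {B : Set 𝓓} (hB : MeasurableSet B) :
    ∀ᵐ c ∂μ.map C, κ c B = κ' c B := by
  have := h.1
  have := h'.1
  refine ae_eq_of_forall_setLIntegral_eq_of_sigmaFinite (Kernel.measurable_coe κ hB)
    (Kernel.measurable_coe κ' hB) fun s hs _ => ?_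
  rw [← Measure.compProd_apply_prod hs hB, ← Measure.compProd_apply_prod hs hB, h.2, h'.2]

/-- Test functions of the coarser condition are test functions of the finer one, so the condition
may be coarsened as long as the kernel still factors through what is kept. -/
theorem IsCondLaw.change_condition [SFinite μ] {C : Ω → 𝓒} {C' : Ω → 𝓥} {D : Ω → 𝓓}
    {κ : Kernel 𝓒 𝓓} {κ' : Kernel 𝓥 𝓓} [IsMarkovKernel κ'] (h : IsCondLaw μ C D κ)
    (hC : Measurable C) (hD : Measurable D) {i : 𝓒 → 𝓥} (hi : Measurable i)
    (hC' : ∀ ω, i (C ω) = C' ω) (hκ : ∀ ω, κ (C ω) = κ' (C' ω)) :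
    IsCondLaw μ C' D κ' := by
  obtain rfl : (fun ω => i (C ω)) = C' := funext hC'
  refine isCondLaw_of_lintegral (hi.comp hC) hD fun f hf => ?_
  rw [h.lintegral_eq hC hD (f := fun p => f (i p.1, p.2))
    (hf.comp ((hi.comp measurable_fst).prodMk measurable_snd))]
  simp_rw [hκ]

/-- The image of a kernel under a map that also depends on the starting point. -/
noncomputable def pushKernel (κ : Kernel 𝓦 𝓓) (g : 𝓦 × 𝓓 → 𝓔) : Kernel 𝓦 𝓔 :=
  (Kernel.id ×ₖ κ).map g

theorem isMarkovKernel_pushKernel (κ : Kernel 𝓦 𝓓) [IsMarkovKernel κ] {g : 𝓦 × 𝓓 → 𝓔}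
    (hg : Measurable g) : IsMarkovKernel (pushKernel κ g) :=
  Kernel.IsMarkovKernel.map _ hg

theorem lintegral_pushKernel (κ : Kernel 𝓦 𝓓) [IsSFiniteKernel κ] {g : 𝓦 × 𝓓 → 𝓔}
    (hg : Measurable g) (w : 𝓦) {f : 𝓔 → ℝ≥0∞} (hf : Measurable f) :
    ∫⁻ e, f e ∂pushKernel κ g w = ∫⁻ d, f (g (w, d)) ∂κ w := by
  rw [pushKernel, Kernel.lintegral_map _ hg _ hf,
    Kernel.lintegral_id_prod (f := fun p => f (g p)) (hf.comp hg)]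

/-- The map may read `j (C ω)`, the part of the condition on which the kernel depends; hence the new
kernel still depends on that part only. -/
theorem IsCondLaw.push [SFinite μ] {C : Ω → 𝓒} {D : Ω → 𝓓} {κ : Kernel 𝓦 𝓓} [IsMarkovKernel κ]
    {j : 𝓒 → 𝓦} (hj : Measurable j) (h : IsCondLaw μ C D (κ.comap j hj)) (hC : Measurable C)
    (hD : Measurable D) {g : 𝓦 × 𝓓 → 𝓔} (hg : Measurable g) :
    IsCondLaw μ C (fun ω => g (j (C ω), D ω)) ((pushKernel κ g).comap j hj) := by
  have := isMarkovKernel_pushKernel κ hg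
  refine isCondLaw_of_lintegral hC (hg.comp ((hj.comp hC).prodMk hD)) fun f hf => ?_
  rw [h.lintegral_eq hC hD (f := fun p => f (p.1, g (j p.1, p.2)))
    (hf.comp (measurable_fst.prodMk (hg.comp ((hj.comp measurable_fst).prodMk measurable_snd))))]
  refine lintegral_congr fun ω => ?_
  rw [Kernel.comap_apply, Kernel.comap_apply,
    lintegral_pushKernel κ hg _ (f := fun e => f (C ω, e)) (hf.comp measurable_prodMk_left)]

/-- Independent noise, split into one part that is added to the condition and one part that is
added to the conditioned variable. -/
theorem IsCondLaw.add_noise [IsProbabilityMeasure μ] {C : Ω → 𝓒} {D : Ω → 𝓓} {κ : Kernel 𝓦 𝓓}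
    [IsMarkovKernel κ] {j : 𝓒 → 𝓦} (hj : Measurable j) (h : IsCondLaw μ C D (κ.comap j hj))
    (hC : Measurable C) (hD : Measurable D) {e₁ : Ω → 𝓔} {e₂ : Ω → 𝓥} (he₁ : Measurable e₁)
    (he₂ : Measurable e₂)
    (hind : IndepFun (fun ω => (C ω, D ω)) (fun ω => (e₁ ω, e₂ ω)) μ) (hind' : IndepFun e₁ e₂ μ)
    {N : Measure 𝓥} [IsProbabilityMeasure N] (hN : μ.map e₂ = N) :
    IsCondLaw μ (fun ω => (C ω, e₁ ω)) (fun ω => (D ω, e₂ ω))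
      ((κ ×ₖ Kernel.const 𝓦 N).comap (fun p => j p.1) (hj.comp measurable_fst)) := by
  have := Measure.isProbabilityMeasure_map (μ := μ) he₁.aemeasurable
  refine isCondLaw_of_lintegral (hC.prodMk he₁) (hD.prodMk he₂) fun f hf => ?_
  have hCD := hC.prodMk hD
  have hf' : Measurable fun p : (𝓒 × 𝓓) × (𝓔 × 𝓥) => f ((p.1.1, p.2.1), (p.1.2, p.2.2)) :=
    hf.comp (by fun_prop)
  -- The joint law of all four variables is that of `(C, D)` times that of `e₁` times `N`; the rest
  -- is Fubini.
  have hlaw := (indepFun_iff_map_prod_eq_prod_map_map hCD.aemeasurable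
    (he₁.prodMk he₂).aemeasurable).1 hind
  rw [(indepFun_iff_map_prod_eq_prod_map_map he₁.aemeasurable he₂.aemeasurable).1 hind', hN] at hlaw
  have hlaw₁ := (indepFun_iff_map_prod_eq_prod_map_map hC.aemeasurable he₁.aemeasurable).1
    (hind.comp measurable_fst measurable_fst)
  have hF : Measurable fun q : (𝓒 × 𝓓) × 𝓔 => ∫⁻ e', f ((q.1.1, q.2), (q.1.2, e')) ∂N :=
    Measurable.lintegral_prod_right' (f := fun r : ((𝓒 × 𝓓) × 𝓔) × 𝓥 =>
      f ((r.1.1.1, r.1.2), (r.1.1.2, r.2))) (hf.comp (by fun_prop))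
  have hG : Measurable fun q : 𝓒 × 𝓓 =>
      ∫⁻ e, ∫⁻ e', f ((q.1, e), (q.2, e')) ∂N ∂μ.map e₁ := hF.lintegral_prod_right'
  have hK : Measurable fun p : 𝓒 × 𝓔 =>
      ∫⁻ d, ∫⁻ e', f (p, (d, e')) ∂N ∂κ (j p.1) := by
    refine Measurable.lintegral_kernel_prod_right'
      (κ := κ.comap (fun p : 𝓒 × 𝓔 => j p.1) (hj.comp measurable_fst))
      (f := fun q : (𝓒 × 𝓔) × 𝓓 => ∫⁻ e', f (q.1, (q.2, e')) ∂N) ?_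
    exact Measurable.lintegral_prod_right' (f := fun r : ((𝓒 × 𝓔) × 𝓓) × 𝓥 =>
      f (r.1.1, (r.1.2, r.2))) (hf.comp (by fun_prop))
  calc ∫⁻ ω, f ((C ω, e₁ ω), (D ω, e₂ ω)) ∂μ
      = ∫⁻ p, f ((p.1.1, p.2.1), (p.1.2, p.2.2))
          ∂μ.map (fun ω => ((C ω, D ω), (e₁ ω, e₂ ω))) := by
        rw [lintegral_map hf' (hCD.prodMk (he₁.prodMk he₂))]
    _ = ∫⁻ q, ∫⁻ e, ∫⁻ e', f ((q.1, e), (q.2, e')) ∂N ∂μ.map e₁ ∂μ.map (fun ω => (C ω, D ω)) := by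
        rw [hlaw, lintegral_prod _ hf'.aemeasurable]
        refine lintegral_congr fun q => ?_
        exact lintegral_prod (fun r : 𝓔 × 𝓥 => f ((q.1, r.1), (q.2, r.2)))
          (hf.comp (by fun_prop)).aemeasurable
    _ = ∫⁻ ω, ∫⁻ d, ∫⁻ e, ∫⁻ e', f ((C ω, e), (d, e')) ∂N ∂μ.map e₁ ∂κ (j (C ω)) ∂μ := by
        rw [lintegral_map hG hCD, h.lintegral_eq hC hD hG]
        rfl
    _ = ∫⁻ ω, ∫⁻ e, ∫⁻ d, ∫⁻ e', f ((C ω, e), (d, e')) ∂N ∂κ (j (C ω)) ∂μ.map e₁ ∂μ := by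
        refine lintegral_congr fun ω => ?_
        rw [lintegral_lintegral_swap]
        exact (hF.comp (by fun_prop : Measurable fun p : 𝓓 × 𝓔 => ((C ω, p.1), p.2))).aemeasurable
    _ = ∫⁻ p, ∫⁻ d, ∫⁻ e', f (p, (d, e')) ∂N ∂κ (j p.1) ∂μ.map (fun ω => (C ω, e₁ ω)) := by
        rw [hlaw₁, lintegral_prod _ hK.aemeasurable, lintegral_map hK.lintegral_prod_right' hC]
    _ = _ := by
        rw [lintegral_map hK (hC.prodMk he₁)]
        refine lintegral_congr fun ω => ?_
        rw [Kernel.comap_apply, Kernel.lintegral_prod _ _ _ (g := fun r : 𝓓 × 𝓥 =>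
          f ((C ω, e₁ ω), r)) (hf.comp measurable_prodMk_left)]
        rfl

/-- Part of the conditioned variable is moved to the condition. -/
theorem IsCondLaw.disintegrate [SFinite μ] [StandardBorelSpace 𝓓] [Nonempty 𝓓]
    [StandardBorelSpace 𝓔] {C : Ω → 𝓒} {x : Ω → 𝓔} {D : Ω → 𝓓} {κ : Kernel 𝓦 (𝓔 × 𝓓)}
    [IsMarkovKernel κ] {j : 𝓒 → 𝓦} (hj : Measurable j)
    (h : IsCondLaw μ C (fun ω => (x ω, D ω)) (κ.comap j hj)) (hC : Measurable C)
    (hx : Measurable x) (hD : Measurable D) :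
    IsCondLaw μ (fun ω => (C ω, x ω)) D
      (κ.condKernel.comap (Prod.map j id) (hj.prodMap measurable_id)) := by
  refine isCondLaw_of_lintegral (hC.prodMk hx) hD fun f hf => ?_
  have hg : Measurable fun p : 𝓒 × 𝓔 =>
      ∫⁻ d, f (p, d) ∂κ.condKernel.comap (Prod.map j id) (hj.prodMap measurable_id) p :=
    hf.lintegral_kernel_prod_right'
  -- The hypothesis is used on both sides: for `f` itself and for `f` with its last argument
  -- averaged by the disintegration kernel. It remains to compare two integrals against the same `κ
  -- (j (C ω))`.
  rw [h.lintegral_eq hC (hx.prodMk hD) (f := fun p => f ((p.1, p.2.1), p.2.2))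
    (hf.comp (by fun_prop)),
    h.lintegral_eq hC (hx.prodMk hD) (f := fun p => ∫⁻ d, f ((p.1, p.2.1), d)
      ∂κ.condKernel.comap (Prod.map j id) (hj.prodMap measurable_id) (p.1, p.2.1))
    (hg.comp (by fun_prop : Measurable fun p : 𝓒 × (𝓔 × 𝓓) => (p.1, p.2.1)))]
  refine lintegral_congr fun ω => ?_
  rw [Kernel.comap_apply]
  have h1 := κ.disintegrate κ.condKernel
  rw [← Kernel.lintegral_fst κ (j (C ω)) (g := fun y => ∫⁻ d, f ((C ω, y), d)
      ∂κ.condKernel.comap (Prod.map j id) (hj.prodMap measurable_id) (C ω, y))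
    (hg.comp measurable_prodMk_left)]
  conv_lhs => rw [← h1]
  rw [Kernel.lintegral_compProd _ _ _ (f := fun d : 𝓔 × 𝓓 => f ((C ω, d.1), d.2))
    (hf.comp (by fun_prop))]
  rfl

/-- The bridge from kernels to the conditional expectations in which conditional independence is
stated. -/
theorem IsCondLaw.condExp_indicator [IsFiniteMeasure μ] {C : Ω → 𝓒} {D : Ω → 𝓓}
    {κ : Kernel 𝓒 𝓓} (h : IsCondLaw μ C D κ) (hC : Measurable C) (hD : Measurable D)
    {B : Set 𝓓} (hB : MeasurableSet B) :
    (fun ω => (κ (C ω)).real B) =ᵐ[μ] condExp (MeasurableSpace.comap C inferInstance) μ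
      ((D ⁻¹' B).indicator fun _ => (1 : ℝ)) := by
  have := h.1
  have hm : Measurable fun c => (κ c).real B := (Kernel.measurable_coe κ hB).ennreal_toReal
  have hint : Integrable (fun ω => (κ (C ω)).real B) μ := by
    refine Integrable.of_bound (hm.comp hC).aestronglyMeasurable 1 (ae_of_all _ fun ω => ?_)
    rw [Real.norm_of_nonneg measureReal_nonneg]
    exact measureReal_le_one
  refine ae_eq_condExp_of_forall_setIntegral_eq hC.comap_le
    ((integrable_const (1 : ℝ)).indicator (hD hB)) (fun s _ _ => hint.integrableOn) ?_
    (hm.comp (comap_measurable C)).stronglyMeasurable.aestronglyMeasurable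
  rintro _ ⟨A, hA, rfl⟩ -
  rw [integral_indicator (hD hB), setIntegral_const, smul_eq_mul, mul_one,
    measureReal_restrict_apply' (hC hA)]
  have h1 := congrArg (fun m => m (A ×ˢ B)) h.2
  rw [Measure.compProd_apply_prod hA hB, Measure.map_apply (hC.prodMk hD) (hA.prod hB),
    setLIntegral_map hA (Kernel.measurable_coe κ hB) hC] at h1
  simp only [Measure.real]
  have hκm : Measurable fun ω => κ (C ω) B := (Kernel.measurable_coe κ hB).comp hC
  rw [integral_toReal hκm.aemeasurable
    (ae_of_all _ fun ω => measure_lt_top _ _), h1]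
  congr 2
  ext ω
  simp [and_comm]

/-- Under conditional independence, the independent variable may be added to the condition. -/
theorem CondIndepGiven.isCondLaw [IsFiniteMeasure μ] {f : Ω → 𝓔} {g : Ω → 𝓥} {h : Ω → 𝓒}
    (hind : CondIndepGiven μ f g h) (hf : Measurable f) (hg : Measurable g) (hh : Measurable h)
    {r : 𝓔 → 𝓓} (hr : Measurable r) {κ : Kernel 𝓒 𝓓}
    (hκ : IsCondLaw μ h (fun ω => r (f ω)) κ) :
    IsCondLaw μ (fun ω => (h ω, g ω)) (fun ω => r (f ω)) (κ.comap Prod.fst measurable_fst) := by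
  have := hκ.1
  have hD : Measurable fun ω => r (f ω) := hr.comp hf
  refine ⟨inferInstance, ?_⟩
  refine Measure.ext_prod₃' fun {A₁ A₂ B} hA₁ hA₂ hB => ?_
  rw [Measure.compProd_apply_prod (hA₁.prod hA₂) hB,
    setLIntegral_map (hA₁.prod hA₂) (Kernel.measurable_coe _ hB) (hh.prodMk hg),
    Measure.map_apply ((hh.prodMk hg).prodMk hD) ((hA₁.prod hA₂).prod hB)]
  have hm : Measurable fun c => (κ c).real B := (Kernel.measurable_coe κ hB).ennreal_toReal
  have hbd : ∀ ω, ‖(κ (h ω)).real B‖ ≤ 1 := fun ω => by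
    rw [Real.norm_of_nonneg measureReal_nonneg]
    exact measureReal_le_one
  have hgi : Integrable ((g ⁻¹' A₂).indicator fun _ => (1 : ℝ)) μ :=
    (integrable_const (1 : ℝ)).indicator (hg hA₂)
  have hθg : Integrable ((fun ω => (κ (h ω)).real B) *
      (g ⁻¹' A₂).indicator fun _ => (1 : ℝ)) μ :=
    hgi.bdd_mul (hm.comp hh).aestronglyMeasurable (ae_of_all _ hbd)
  have e1 := hind (r ⁻¹' B) A₂ (hr hB) hA₂
  have e2 := hκ.condExp_indicator hh hD hB
  have e3 := condExp_mul_of_stronglyMeasurable_left (μ := μ)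
    (hm.comp (comap_measurable h)).stronglyMeasurable hθg hgi
  -- Both integrands have the same conditional expectation given `h`: conditional independence
  -- factors the left one, and the kernel probability is pulled out of the right one.
  have key : ∫ ω in h ⁻¹' A₁, (f ⁻¹' (r ⁻¹' B) ∩ g ⁻¹' A₂).indicator (fun _ => (1 : ℝ)) ω ∂μ =
      ∫ ω in h ⁻¹' A₁, ((fun ω => (κ (h ω)).real B) *
        (g ⁻¹' A₂).indicator fun _ => (1 : ℝ)) ω ∂μ := by
    have hs : MeasurableSet[MeasurableSpace.comap h inferInstance] (h ⁻¹' A₁) := ⟨A₁, hA₁, rfl⟩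
    rw [← setIntegral_condExp hh.comap_le
      ((integrable_const (1 : ℝ)).indicator ((hf (hr hB)).inter (hg hA₂))) hs,
      ← setIntegral_condExp hh.comap_le hθg hs]
    refine integral_congr_ae (ae_restrict_of_ae ?_)
    filter_upwards [e1, e2, e3] with ω h1 h2 h3
    refine h1.trans (Eq.trans ?_ h3.symm)
    rw [Pi.mul_apply]
    congr 1
    exact h2.symm
  rw [integral_indicator ((hf (hr hB)).inter (hg hA₂)), setIntegral_const, smul_eq_mul, mul_one,
    measureReal_restrict_apply' (hh hA₁)] at key
  have e4 : ((fun ω => (κ (h ω)).real B) * (g ⁻¹' A₂).indicator fun _ => (1 : ℝ)) =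
      (g ⁻¹' A₂).indicator fun ω => (κ (h ω)).real B := by
    ext ω
    by_cases hω : ω ∈ g ⁻¹' A₂ <;> simp [hω]
  rw [e4, setIntegral_indicator (hg hA₂)] at key
  simp only [Measure.real] at key
  have hκm : Measurable fun ω => κ (h ω) B := (Kernel.measurable_coe κ hB).comp hh
  rw [integral_toReal hκm.aemeasurable
    (ae_of_all _ fun ω => measure_lt_top _ _), ENNReal.toReal_eq_toReal_iff'
      (measure_ne_top _ _) (ne_of_lt ((setLIntegral_mono measurable_one fun ω _ => prob_le_one).trans_lt
        (by simp)))] at key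
  refine Eq.trans ?_ (key.symm.trans ?_)
  · rfl
  · congr 1
    ext ω
    simp only [Set.mem_inter_iff, Set.mem_preimage, Set.mem_prod]
    tauto

end CondLaw

/-! ### Unordered sequences of neighbors -/

section Unordered

variable {ι ι' Z : Type*}

theorem unordered_of_finite (z : ι → Z) {A : Set ι} (hA : A.Finite) :
    unordered z A = (hA.toFinset.val.map z : Multiset Z) := dif_pos hA

theorem unordered_of_infinite (z : ι → Z) {A : Set ι} (hA : ¬ A.Finite) :
    unordered z A = (0 : Multiset Z) := dif_neg hA

/-- For a fixed finite index set, an arbitrary enumeration reduces the unordered sequence to the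
continuous map `UnorderedSeq.ofTuple`. -/
theorem unordered_coe (z : ι → Z) (s : Finset ι) :
    unordered z (s : Set ι) = UnorderedSeq.ofTuple s.toList.length fun i => z (s.toList.get i) := by
  have h : List.ofFn (fun i => z (s.toList.get i)) = s.toList.map z := by
    apply List.ext_getElem <;> simp
  rw [unordered_of_finite z s.finite_toSet, UnorderedSeq.ofTuple, h, Finset.finite_toSet_toFinset,
    ← Multiset.map_coe, Finset.coe_toList]

theorem unordered_congr {z z' : ι → Z} {A : Set ι} (h : Set.EqOn z z' A) :
    unordered z A = unordered z' A := by
  by_cases hA : A.Finite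
  · rw [unordered_of_finite z hA, unordered_of_finite z' hA]
    exact Multiset.map_congr rfl fun u hu => h (hA.mem_toFinset.1 hu)
  · rw [unordered_of_infinite z hA, unordered_of_infinite z' hA]

theorem unordered_image {i : ι → ι'} (hi : Function.Injective i) (z : ι' → Z) (A : Set ι) :
    unordered z (i '' A) = unordered (fun u => z (i u)) A := by
  classical
  by_cases hA : A.Finite
  · rw [unordered_of_finite _ hA, unordered_of_finite _ (hA.image i),
      Set.Finite.toFinset_image i hA (hA.image i),
      Finset.image_val_of_injOn hi.injOn, Multiset.map_map]
    rfl
  · rw [unordered_of_infinite _ hA,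
      unordered_of_infinite _ fun h => hA (h.of_finite_image hi.injOn)]

/-- A countable index set has only countably many finite subsets, and for each of them the map is
continuous in the values; on infinite sets it is constant. -/
theorem measurable_unordered [Countable ι] [TopologicalSpace Z] [SecondCountableTopology Z]
    [MeasurableSpace Z] [BorelSpace Z] :
    Measurable fun p : Set ι × (ι → Z) => unordered p.2 p.1 := by
  have h1 : ∀ s : Finset ι, Measurable fun z : ι → Z => unordered z (s : Set ι) := by
    intro s
    simp_rw [unordered_coe]
    have hc : Continuous (UnorderedSeq.ofTuple (Z := Z) s.toList.length) :=
      continuous_iff_coinduced_le.2 (le_iSup (fun n : ℕ =>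
        TopologicalSpace.coinduced (UnorderedSeq.ofTuple (Z := Z) n) inferInstance) _)
    exact hc.measurable.comp (by fun_prop)
  intro B hB
  have h2 : (fun p : Set ι × (ι → Z) => unordered p.2 p.1) ⁻¹' B =
      (⋃ s : Finset ι, ({(s : Set ι)} : Set (Set ι)) ×ˢ
        ((fun z : ι → Z => unordered z (s : Set ι)) ⁻¹' B)) ∪
      {A : Set ι | ¬ A.Finite} ×ˢ {_z : ι → Z | ((0 : Multiset Z) : UnorderedSeq Z) ∈ B} := by
    ext ⟨A, z⟩
    by_cases hA : A.Finite
    · obtain ⟨s, rfl⟩ := hA.exists_finset_coe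
      simp
    · have h3 : ∀ s : Finset ι, A ≠ s := fun s h => hA (h ▸ s.finite_toSet)
      have hA' : A.Infinite := hA
      simp [h3, unordered_of_infinite z hA, hA']
      exact Iff.rfl
  rw [h2]
  refine (MeasurableSet.iUnion fun s => (measurableSet_singleton _).prod (h1 s hB)).union
    (MeasurableSet.prod (MeasurableSet.setOfPred_finite.compl) ?_)
  exact MeasurableSet.const _

end Unordered

/-! ### Neighborhoods of vertices and the one-step map -/

/-- Adjacency of labels in the full tree. -/
def Adj (u v : Label) : Prop := (∃ k : ℕ+, v = u ++ [k]) ∨ (∃ k : ℕ+, u = v ++ [k])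

/-- The labels `v ++ u` together with the parent of `v`, which corresponds to `none`. -/
def coneEmb (v : Label) : Option Label → Label
  | none => v.dropLast
  | some u => v ++ u

/-- Adjacency to `u` in the coordinates of `coneEmb`. -/
def ConeAdj (w : Option Label) (u : Label) : Prop :=
  match w with
  | none => u = []
  | some w => Adj w u

theorem coneEmb_injective {v : Label} (hv : v ≠ []) : Function.Injective (coneEmb v) := by
  have h : ∀ u : Label, v.dropLast ≠ v ++ u := by
    intro u hu
    have h1 := congrArg List.length hu
    have h2 := List.length_pos_of_ne_nil hv
    simp only [List.length_dropLast, List.length_append] at h1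
    omega
  rintro (_ | a) (_ | b) hab
  · rfl
  · exact absurd hab (h b)
  · exact absurd hab.symm (h a)
  · exact congrArg some (List.append_cancel_left hab)

/-- A vertex of the cone at v has all its neighbors in the cone, except that v itself is also
adjacent to its parent. -/
theorem adj_append_iff {v : Label} (hv : v ≠ []) (w u : Label) :
    Adj w (v ++ u) ↔ ∃ w', ConeAdj w' u ∧ coneEmb v w' = w := by
  constructor
  · rintro (⟨k, hk⟩ | ⟨k, hk⟩)
    · rcases List.eq_nil_or_concat u with rfl | ⟨u', k', rfl⟩
      · refine ⟨none, rfl, ?_⟩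
        rw [List.append_nil] at hk
        simp [coneEmb, hk]
      · refine ⟨some u', Or.inl ⟨k', by simp⟩, ?_⟩
        rw [List.concat_eq_append, ← List.append_assoc] at hk
        exact (List.append_inj' hk rfl).1
    · exact ⟨some (u ++ [k]), Or.inr ⟨k, rfl⟩, by simp [coneEmb, hk]⟩
  · rintro ⟨_ | w', h, rfl⟩
    · refine Or.inl ⟨v.getLast hv, ?_⟩
      rw [show u = [] from h, List.append_nil]
      exact (List.dropLast_append_getLast hv).symm
    · rcases h with ⟨k, hk⟩ | ⟨k, hk⟩
      · exact Or.inl ⟨k, by simp [coneEmb, hk]⟩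
      · exact Or.inr ⟨k, by simp [coneEmb, hk]⟩

theorem mem_nbrs_iff {T : Set Label} {u v : Label} : u ∈ nbrs T v ↔ u ∈ T ∧ v ∈ T ∧ Adj u v :=
  Iff.rfl

theorem measurable_nbrs (v : Label) : Measurable fun T : Set Label => nbrs T v := by
  refine measurable_set_iff.2 fun u => ?_
  exact (measurable_set_mem u).and ((measurable_set_mem v).and measurable_const)

section Step

variable {𝓧 Ξ : Type*} (ϖ : 𝓧) {k : ℕ}

/-- The set of vertices that are not in the cemetery state at time `0`. -/
def alive {ι : Type*} (s : ι → Fin (k + 1) → 𝓧) : Set ι := {v | s v 0 ≠ ϖ}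

/-- The unordered sequence of the histories of the neighbors of `v` in the tree of living
vertices. -/
noncomputable def nbhd (v : Label) (s : Label → Fin (k + 1) → 𝓧) :
    UnorderedSeq (Fin (k + 1) → 𝓧) :=
  unordered s (nbrs (alive ϖ s) v)

/-- `nbhd` in the coordinates of `coneEmb`. -/
noncomputable def coneNbhd (u : Label) (s : Option Label → Fin (k + 1) → 𝓧) :
    UnorderedSeq (Fin (k + 1) → 𝓧) :=
  unordered s {w | w ∈ alive ϖ s ∧ some u ∈ alive ϖ s ∧ ConeAdj w u}

/-- In cone coordinates the neighborhood is given by a map that does not involve v. This is where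
homogeneity in v comes from. -/
theorem nbhd_append {v : Label} (hv : v ≠ []) (u : Label) (s : Label → Fin (k + 1) → 𝓧) :
    nbhd ϖ (v ++ u) s = coneNbhd ϖ u fun w => s (coneEmb v w) := by
  rw [nbhd, coneNbhd, ← unordered_image (coneEmb_injective hv) s]
  congr 1
  ext w
  rw [mem_nbrs_iff, adj_append_iff hv]
  constructor
  · rintro ⟨h1, h2, w', h3, rfl⟩
    exact ⟨w', ⟨h1, h2, h3⟩, rfl⟩
  · rintro ⟨w', ⟨h1, h2, h3⟩, rfl⟩
    exact ⟨h1, h2, w', h3, rfl⟩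

theorem nbhd_congr {v : Label} {s s' : Label → Fin (k + 1) → 𝓧} (hv : s v = s' v)
    (h : ∀ u, Adj u v → s u = s' u) : nbhd ϖ v s = nbhd ϖ v s' := by
  have h1 : nbrs (alive ϖ s) v = nbrs (alive ϖ s') v := by
    ext u
    simp only [mem_nbrs_iff, alive, Set.mem_ofPred_eq, hv]
    constructor
    · rintro ⟨a, b, c⟩
      exact ⟨h u c ▸ a, b, c⟩
    · rintro ⟨a, b, c⟩
      exact ⟨(h u c).symm ▸ a, b, c⟩
  rw [nbhd, nbhd, h1]
  exact unordered_congr fun u hu => h u hu.2.2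

open Classical in
/-- The new states of all the vertices. -/
noncomputable def step (F : Update 𝓧 Ξ) (s : Label → Fin (k + 1) → 𝓧) (e : Label → Ξ)
    (v : Label) : 𝓧 :=
  if v ∈ alive ϖ s then F k (s v) (nbhd ϖ v s) (e v) else ϖ

open Classical in
/-- The new states of the vertices of a cone, in the coordinates of `coneEmb`. -/
noncomputable def coneStep (F : Update 𝓧 Ξ) (s : Option Label → Fin (k + 1) → 𝓧) (e : Label → Ξ)
    (u : Label) : 𝓧 :=
  if some u ∈ alive ϖ s then F k (s (some u)) (coneNbhd ϖ u s) (e u) else ϖ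

/-- The update inside a cone reads only the cone, its parent and the noise in the cone, and is the
same map for every v. -/
theorem step_append (F : Update 𝓧 Ξ) {v : Label} (hv : v ≠ []) (s : Label → Fin (k + 1) → 𝓧)
    (e : Label → Ξ) (u : Label) :
    step ϖ F s e (v ++ u) = coneStep ϖ F (fun w => s (coneEmb v w)) (fun u => e (v ++ u)) u := by
  rw [step, coneStep, nbhd_append ϖ hv]
  rfl

theorem step_congr (F : Update 𝓧 Ξ) {v : Label} {s s' : Label → Fin (k + 1) → 𝓧}
    {e e' : Label → Ξ} (hv : s v = s' v) (h : ∀ u, Adj u v → s u = s' u) (he : e v = e' v) :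
    step ϖ F s e v = step ϖ F s' e' v := by
  have h1 : v ∈ alive ϖ s ↔ v ∈ alive ϖ s' := by simp only [alive, Set.mem_ofPred_eq, hv]
  unfold step
  by_cases h2 : v ∈ alive ϖ s
  · rw [if_pos h2, if_pos (h1.1 h2), nbhd_congr ϖ hv h, hv, he]
  · rw [if_neg h2, if_neg (mt h1.2 h2)]

variable [MeasurableSpace 𝓧] [MeasurableSingletonClass 𝓧]

theorem measurable_alive {ι : Type*} :
    Measurable fun s : ι → Fin (k + 1) → 𝓧 => alive ϖ s := by
  refine measurable_set_iff.2 fun v => ?_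
  exact measurableSet_setOfPred.1 ((measurableSet_singleton ϖ).compl.preimage (by fun_prop :
    Measurable fun s : ι → Fin (k + 1) → 𝓧 => s v 0))

variable [TopologicalSpace 𝓧] [SecondCountableTopology 𝓧] [BorelSpace 𝓧] [MeasurableSpace Ξ]

theorem measurable_nbhd (v : Label) :
    Measurable fun s : Label → Fin (k + 1) → 𝓧 => nbhd ϖ v s :=
  measurable_unordered.comp (((measurable_nbrs v).comp (measurable_alive ϖ)).prodMk measurable_id)

theorem measurable_coneNbhd (u : Label) :
    Measurable fun s : Option Label → Fin (k + 1) → 𝓧 => coneNbhd ϖ u s := by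
  refine measurable_unordered.comp (Measurable.prodMk (measurable_set_iff.2 fun w => ?_)
    measurable_id)
  have h := fun w => (measurable_set_mem w).comp (measurable_alive (k := k) (ι := Option Label) ϖ)
  exact (h w).and ((h (some u)).and measurable_const)

/-- Measurability of the update functions. -/
def MeasurableUpdate (F : Update 𝓧 Ξ) : Prop :=
  ∀ k, Measurable fun p : (Fin (k + 1) → 𝓧) × UnorderedSeq (Fin (k + 1) → 𝓧) × Ξ =>
    F k p.1 p.2.1 p.2.2

variable {ϖ}

theorem measurable_step {F : Update 𝓧 Ξ} (hF : MeasurableUpdate F) :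
    Measurable fun p : (Label → Fin (k + 1) → 𝓧) × (Label → Ξ) => step ϖ F p.1 p.2 := by
  refine measurable_pi_iff.2 fun v => Measurable.ite ?_ ?_ measurable_const
  · exact measurableSet_setOfPred.2 ((measurable_set_mem v).comp
      ((measurable_alive ϖ).comp measurable_fst))
  · exact (hF k).comp (Measurable.prodMk (by fun_prop) (Measurable.prodMk
      ((measurable_nbhd ϖ v).comp measurable_fst) (by fun_prop)))

theorem measurable_coneStep {F : Update 𝓧 Ξ} (hF : MeasurableUpdate F) :
    Measurable fun p : (Option Label → Fin (k + 1) → 𝓧) × (Label → Ξ) =>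
      coneStep ϖ F p.1 p.2 := by
  refine measurable_pi_iff.2 fun u => Measurable.ite ?_ ?_ measurable_const
  · exact measurableSet_setOfPred.2 ((measurable_set_mem (some u)).comp
      ((measurable_alive ϖ).comp measurable_fst))
  · exact (hF k).comp (Measurable.prodMk (by fun_prop) (Measurable.prodMk
      ((measurable_coneNbhd ϖ u).comp measurable_fst) (by fun_prop)))

end Step

/-! ### Independence of the fresh noise -/

section Noise

variable {Ω : Type*} [MeasurableSpace Ω] {μ : Measure Ω}

/-- Independence of two infinite families is checked on finite subfamilies, whose images in the
index set are disjoint. -/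
theorem indepFun_of_disjoint_range {α β ι Ξ : Type*} [MeasurableSpace Ξ] {ξ : ι → Ω → Ξ}
    [IsProbabilityMeasure μ] (h : iIndepFun ξ μ) (hm : ∀ i, Measurable (ξ i)) {f : α → ι}
    {g : β → ι} (hfg : ∀ a b, f a ≠ g b) :
    IndepFun (fun ω a => ξ (f a) ω) (fun ω b => ξ (g b) ω) μ := by
  classical
  refine IndepFun.process_indepFun_process (fun a => hm (f a)) (fun b => hm (g b)) fun I J => ?_
  have hd : Disjoint (I.image f) (J.image g) := by
    rw [Finset.disjoint_left]
    intro i hi hj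
    obtain ⟨a, -, rfl⟩ := Finset.mem_image.1 hi
    obtain ⟨b, -, hb⟩ := Finset.mem_image.1 hj
    exact hfg a b hb.symm
  have := h.indepFun_finset _ _ hd hm
  exact this.comp
    (φ := fun (z : I.image f → Ξ) (a : I) => z ⟨f a, Finset.mem_image_of_mem f a.2⟩)
    (ψ := fun (z : J.image g → Ξ) (b : J) => z ⟨g b, Finset.mem_image_of_mem g b.2⟩)
    (by fun_prop) (by fun_prop)

/-- The three variables have a product law, which can be bracketed either way. -/
theorem IndepFun.assoc_of_indepFun {𝓐 𝓑 𝓒 : Type*} [MeasurableSpace 𝓐] [MeasurableSpace 𝓑]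
    [MeasurableSpace 𝓒] [IsProbabilityMeasure μ] {f : Ω → 𝓐} {g : Ω → 𝓑} {h : Ω → 𝓒}
    (hf : Measurable f) (hg : Measurable g) (hh : Measurable h)
    (h1 : IndepFun f (fun ω => (g ω, h ω)) μ) (h2 : IndepFun g h μ) :
    IndepFun (fun ω => (f ω, g ω)) h μ := by
  have := Measure.isProbabilityMeasure_map (μ := μ) hf.aemeasurable
  have := Measure.isProbabilityMeasure_map (μ := μ) hg.aemeasurable
  have := Measure.isProbabilityMeasure_map (μ := μ) hh.aemeasurable
  have e1 := h1.map_prod_eq_prod_map_map hf.aemeasurable (hg.prodMk hh).aemeasurable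
  have e2 := h2.map_prod_eq_prod_map_map hg.aemeasurable hh.aemeasurable
  have e3 := (h1.comp measurable_id measurable_fst).map_prod_eq_prod_map_map hf.aemeasurable
    hg.aemeasurable
  rw [indepFun_iff_map_prod_eq_prod_map_map (hf.prodMk hg).aemeasurable hh.aemeasurable]
  rw [e2, ← Measure.prodAssoc_prod] at e1
  have e4 : (Measure.map (fun ω => (f ω, g ω)) μ) = (μ.map f).prod (μ.map g) := e3
  rw [e4]
  refine MeasurableEquiv.prodAssoc.map_measurableEquiv_injective (Eq.trans ?_ e1)
  rw [Measure.map_map MeasurableEquiv.prodAssoc.measurable (by fun_prop)]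
  rfl

end Noise

/-! ### The Markov random field property -/

section MRF

variable {Ω 𝓧 Ξ : Type*}

/-- The labels that are not strictly below `v`. -/
abbrev NotBelow (v : Label) : Type := {u : Label // u ∉ below v}

theorem self_notMem_below (v : Label) : v ∉ below v := fun h => h.2 rfl

theorem dropLast_notMem_below (v : Label) : v.dropLast ∉ below v := fun h =>
  h.2 ((List.dropLast_prefix v).eq_of_length_le h.1.length_le)

/-- The neighbors of vertices outside of the cone at `v` are not strictly below `v`. -/
theorem notMem_below_of_adj {v u u' : Label} (h : ¬ v <+: u) (h' : Adj u' u) : u' ∉ below v := by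
  rintro ⟨h1, h2⟩
  rcases h' with ⟨k, rfl⟩ | ⟨k, rfl⟩
  · exact h (h1.trans (List.prefix_append _ _))
  · rcases List.prefix_concat_iff.1 h1 with h3 | h3
    · exact h2 h3.symm
    · exact h h3

/-- The states of `v` and of its parent. -/
def edgeState {S : Type*} (v : Label) (c : NotBelow v → S) : S × S :=
  (c ⟨v, self_notMem_below v⟩, c ⟨v.dropLast, dropLast_notMem_below v⟩)

theorem measurable_edgeState {S : Type*} [MeasurableSpace S] (v : Label) :
    Measurable (edgeState (S := S) v) := by
  unfold edgeState
  fun_prop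

/-- The random field `S` on the labels is a Markov random field with a homogeneous cone kernel: `Λ`
is, for all `v ≠ ø`, the conditional law of the states strictly below `v` given all other states,
which depends only on the states of `v` and its parent. -/
def IsConeMarkov {S : Type*} [MeasurableSpace Ω] [MeasurableSpace S] (μ : Measure Ω)
    (σ : Ω → Label → S) (Λ : Kernel (S × S) (NonRoot → S)) : Prop :=
  ∀ v : Label, v ≠ [] → IsCondLaw μ (fun ω (u : NotBelow v) => σ ω u)
    (fun ω (u : NonRoot) => σ ω (v ++ u.1)) (Λ.comap (edgeState v) (measurable_edgeState v))

theorem IsConeMarkov.congr {S : Type*} [MeasurableSpace Ω] [MeasurableSpace S] {μ : Measure Ω}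
    {σ σ' : Ω → Label → S} {Λ : Kernel (S × S) (NonRoot → S)} (h : IsConeMarkov μ σ Λ)
    (hσ : σ =ᵐ[μ] σ') : IsConeMarkov μ σ' Λ := by
  intro v hv
  refine (h v hv).congr ?_ ?_ <;>
  · filter_upwards [hσ] with ω hω
    simp only [hω]

/-- A history extended by one more state. -/
def extendHist {k : ℕ} (h : Fin (k + 1) → 𝓧) (x : 𝓧) : Fin (k + 1 + 1) → 𝓧 :=
  Fin.snoc (α := fun _ => 𝓧) h x

theorem hist_succ (x : ℕ → Ω → 𝓧) (k : ℕ) (ω : Ω) :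
    hist x (k + 1) ω = extendHist (hist x k ω) (x (k + 1) ω) := by
  ext i
  refine Fin.lastCases ?_ (fun i => ?_) i
  · simp [hist, extendHist]
  · simp [hist, extendHist]

theorem measurable_extendHist [MeasurableSpace 𝓧] {k : ℕ} :
    Measurable fun p : (Fin (k + 1) → 𝓧) × 𝓧 => extendHist p.1 p.2 := by
  refine measurable_pi_iff.2 fun i => ?_
  refine Fin.lastCases ?_ (fun i => ?_) i
  · simpa [extendHist] using measurable_snd
  · simp only [extendHist, Fin.snoc_castSucc]
    fun_prop

variable {ϖ : 𝓧} {k : ℕ}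

/-- The state on a cone and on the parent of its top, in the coordinates of `coneEmb`. -/
def coneState {S : Type*} (w : S × S) (d : NonRoot → S) : Option Label → S
  | none => w.2
  | some u => if h : u = [] then w.1 else d ⟨u, h⟩

theorem coneState_eq {S : Type*} (v : Label) (s : Label → S) (u : Option Label) :
    coneState (s v, s v.dropLast) (fun u : NonRoot => s (v ++ u.1)) u = s (coneEmb v u) := by
  rcases u with _ | u
  · rfl
  · by_cases hu : u = []
    · subst hu
      simp [coneState, coneEmb]
    · simp [coneState, coneEmb, hu]

theorem measurable_coneState {S : Type*} [MeasurableSpace S] :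
    Measurable fun p : (S × S) × (NonRoot → S) => coneState p.1 p.2 := by
  refine measurable_pi_iff.2 fun u => ?_
  rcases u with _ | u
  · exact measurable_fst.snd
  · by_cases hu : u = []
    · simpa [coneState, hu] using measurable_fst.fst
    · simp only [coneState, hu, dif_neg, not_false_iff]
      fun_prop

open Classical in
/-- Extension of a configuration to the labels strictly below `v` by the state of `v`. -/
noncomputable def fillBelow {S : Type*} (v : Label) (c : NotBelow v → S) (u : Label) : S :=
  if h : u ∈ below v then c ⟨v, self_notMem_below v⟩ else c ⟨u, h⟩

theorem fillBelow_apply {S : Type*} {v u : Label} (h : u ∉ below v) (c : NotBelow v → S) :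
    fillBelow v c u = c ⟨u, h⟩ := dif_neg h

theorem measurable_fillBelow {S : Type*} [MeasurableSpace S] (v : Label) :
    Measurable (fillBelow (S := S) v) := by
  refine measurable_pi_iff.2 fun u => ?_
  by_cases h : u ∈ below v
  · simp only [fillBelow, h, dif_pos]
    fun_prop
  · simp only [fillBelow, h, dif_neg, not_false_iff]
    fun_prop

variable [MeasurableSpace Ω] [TopologicalSpace 𝓧] [PolishSpace 𝓧] [MeasurableSpace 𝓧]
  [BorelSpace 𝓧] [MeasurableSpace Ξ] {μ : Measure Ω} [IsProbabilityMeasure μ]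

/-- The Markov random field property is preserved by one step of the dynamics, and the new cone
kernel depends on the old one only. -/
theorem IsConeMarkov.step {F : Update 𝓧 Ξ} (hF : MeasurableUpdate F) {ν : Measure Ξ}
    [IsProbabilityMeasure ν] (Λ : Kernel ((Fin (k + 1) → 𝓧) × (Fin (k + 1) → 𝓧))
      (NonRoot → Fin (k + 1) → 𝓧)) [IsMarkovKernel Λ] {σ : Ω → Label → Fin (k + 1) → 𝓧}
    (hσ : Measurable σ) (h : IsConeMarkov μ σ Λ) {e : Label → Ω → Ξ} (he : ∀ v, Measurable (e v))
    (heind : iIndepFun e μ) (helaw : ∀ v, μ.map (e v) = ν)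
    (hσe : IndepFun σ (fun ω v => e v ω) μ) :
    ∃ Λ' : Kernel ((Fin (k + 1 + 1) → 𝓧) × (Fin (k + 1 + 1) → 𝓧))
      (NonRoot → Fin (k + 1 + 1) → 𝓧), IsMarkovKernel Λ' ∧
      IsConeMarkov μ (fun ω v =>
        extendHist (σ ω v) (LocalField.step ϖ F (σ ω) (fun v => e v ω) v)) Λ' := by
  have : Nonempty 𝓧 := ⟨ϖ⟩
  let N : Measure (Label → Ξ) := Measure.infinitePi fun _ => ν
  -- From the old edge, the old histories below v and the noise in the cone, `g` computes the new
  -- state of v, kept apart because it later joins the condition, and the new histories below v.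
  let g : ((Fin (k + 1) → 𝓧) × (Fin (k + 1) → 𝓧)) × ((NonRoot → Fin (k + 1) → 𝓧) × (Label → Ξ)) →
      𝓧 × (NonRoot → Fin (k + 1 + 1) → 𝓧) := fun p =>
    (coneStep ϖ F (coneState p.1 p.2.1) p.2.2 [],
      fun u => extendHist (p.2.1 u) (coneStep ϖ F (coneState p.1 p.2.1) p.2.2 u.1))
  have hcs : Measurable fun p : ((Fin (k + 1) → 𝓧) × (Fin (k + 1) → 𝓧)) ×
      ((NonRoot → Fin (k + 1) → 𝓧) × (Label → Ξ)) =>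
      coneStep ϖ F (coneState p.1 p.2.1) p.2.2 := by
    refine (measurable_coneStep hF).comp (Measurable.prodMk ?_ (by fun_prop))
    exact measurable_coneState.comp (by fun_prop : Measurable fun p : ((Fin (k + 1) → 𝓧) ×
      (Fin (k + 1) → 𝓧)) × ((NonRoot → Fin (k + 1) → 𝓧) × (Label → Ξ)) => (p.1, p.2.1))
  have hg : Measurable g := by
    refine Measurable.prodMk (measurable_pi_iff.1 hcs []) (measurable_pi_iff.2 fun u => ?_)
    exact measurable_extendHist.comp (Measurable.prodMk (by fun_prop)
      (measurable_pi_iff.1 hcs u.1))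
  let κ := pushKernel (Λ ×ₖ Kernel.const _ N) g
  have hκ : IsMarkovKernel κ := isMarkovKernel_pushKernel _ hg
  -- The new kernel reads the old edge and the new state of v. The new state of the parent is not
  -- needed, since it depends on nothing strictly below v.
  let w' : (Fin (k + 1 + 1) → 𝓧) × (Fin (k + 1 + 1) → 𝓧) →
      ((Fin (k + 1) → 𝓧) × (Fin (k + 1) → 𝓧)) × 𝓧 := fun w =>
    ((fun i => w.1 i.castSucc, fun i => w.2 i.castSucc), w.1 (Fin.last _))
  have hw' : Measurable w' := by fun_prop
  refine ⟨κ.condKernel.comap w' hw', inferInstance, fun v hv => ?_⟩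
  have hC : Measurable fun ω (u : NotBelow v) => σ ω u := by fun_prop
  have hD : Measurable fun ω (u : NonRoot) => σ ω (v ++ u.1) := by fun_prop
  have he₁ : Measurable fun ω (u : {u : Label // ¬ v <+: u}) => e u ω :=
    measurable_pi_iff.2 fun u => he u
  have he₂ : Measurable fun ω (u : Label) => e (v ++ u) ω := measurable_pi_iff.2 fun u => he _
  have hN : μ.map (fun ω (u : Label) => e (v ++ u) ω) = N := by
    have h1 : iIndepFun (fun u : Label => e (v ++ u)) μ :=
      heind.precomp (List.append_right_injective v)
    rw [h1.map_fun_eq_infinitePi_map fun u => he _]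
    simp [helaw, N]
  -- The noise is split along the cone: outside it joins the condition, inside it joins the
  -- conditioned variable.
  have h1 := (h v hv).add_noise (measurable_edgeState v) hC hD he₁ he₂
    (hσe.comp (φ := fun s => (fun u : NotBelow v => s u, fun u : NonRoot => s (v ++ u.1)))
      (ψ := fun e => (fun u : {u : Label // ¬ v <+: u} => e u, fun u => e (v ++ u)))
      (by fun_prop) (by fun_prop))
    (indepFun_of_disjoint_range heind he fun a b hab => a.2 ⟨b, hab.symm⟩) hN
  have h2 := h1.push _ (hC.prodMk he₁) (hD.prodMk he₂) hg
  have hst : Measurable fun ω => LocalField.step ϖ F (σ ω) (fun v => e v ω) :=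
    (measurable_step hF).comp (hσ.prodMk (measurable_pi_iff.2 he))
  have hD' : Measurable fun ω (u : NonRoot) => extendHist (σ ω (v ++ u.1))
      (LocalField.step ϖ F (σ ω) (fun v => e v ω) (v ++ u.1)) :=
    measurable_pi_iff.2 fun u => measurable_extendHist.comp (Measurable.prodMk (by fun_prop)
      ((measurable_pi_apply _).comp hst))
  have hx : Measurable fun ω => LocalField.step ϖ F (σ ω) (fun v => e v ω) v :=
    measurable_pi_iff.1 hst v
  have hcone : ∀ ω, coneState (edgeState v fun u : NotBelow v => σ ω u)
      (fun u : NonRoot => σ ω (v ++ u.1)) = fun w => σ ω (coneEmb v w) :=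
    fun ω => funext fun w => coneState_eq v (σ ω) w
  have h3 : IsCondLaw μ (fun ω => ((fun u : NotBelow v => σ ω u),
      fun u : {u : Label // ¬ v <+: u} => e u ω))
      (fun ω => (LocalField.step ϖ F (σ ω) (fun v => e v ω) v,
        fun u : NonRoot => extendHist (σ ω (v ++ u.1))
          (LocalField.step ϖ F (σ ω) (fun v => e v ω) (v ++ u.1))))
      (κ.comap (fun p => edgeState v p.1) ((measurable_edgeState v).comp measurable_fst)) := by
    convert! h2 using 2 with ω
    have hs := step_append ϖ F hv (σ ω) (fun v => e v ω)
    have hs₀ := hs []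
    rw [List.append_nil] at hs₀
    simp only [g, hcone, hs, hs₀]
  -- The new states outside the cone are functions of the condition. The histories filled in below v
  -- and the noise extended constantly are dummies that are never read.
  have hout : Measurable fun p : (NotBelow v → Fin (k + 1) → 𝓧) ×
      ({u : Label // ¬ v <+: u} → Ξ) =>
      (p.1, fun u : {u : Label // ¬ v <+: u} =>
        LocalField.step ϖ F (fillBelow v p.1) (fun _ => p.2 u) u) := by
    refine measurable_fst.prodMk (measurable_pi_iff.2 fun u => ?_)
    have h4 : Measurable fun p : (NotBelow v → Fin (k + 1) → 𝓧) × ({u : Label // ¬ v <+: u} → Ξ) =>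
        (fillBelow v p.1, fun _ : Label => p.2 u) :=
      ((measurable_fillBelow v).comp measurable_fst).prodMk (by fun_prop)
    exact measurable_pi_iff.1 ((measurable_step hF).comp h4) u.1
  have hfill : ∀ ω, ∀ u : {u : Label // ¬ v <+: u},
      LocalField.step ϖ F (fillBelow v fun u : NotBelow v => σ ω u) (fun _ => e u ω) u =
        LocalField.step ϖ F (σ ω) (fun v => e v ω) u := fun ω u =>
    step_congr ϖ F (fillBelow_apply (fun h => u.2 h.1) _)
      (fun u' hu' => fillBelow_apply (notMem_below_of_adj u.2 hu') _) rfl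
  -- The outside noise is coarsened to the new outside states, which is all that the next condition
  -- records of it.
  have h4 := h3.change_condition
    (C' := fun ω => ((fun u : NotBelow v => σ ω u), fun u : {u : Label // ¬ v <+: u} =>
      LocalField.step ϖ F (σ ω) (fun v => e v ω) u))
    (κ' := κ.comap (fun p => edgeState v p.1) ((measurable_edgeState v).comp measurable_fst))
    (hC.prodMk he₁) (hx.prodMk hD') hout
    (fun ω => Prod.ext rfl (funext fun u => hfill ω u)) (fun ω => rfl)
  have hC4 : Measurable fun ω => ((fun u : NotBelow v => σ ω u),
      fun u : {u : Label // ¬ v <+: u} => LocalField.step ϖ F (σ ω) (fun v => e v ω) u) :=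
    hC.prodMk (measurable_pi_iff.2 fun u => measurable_pi_iff.1 hst _)
  -- The new state of v, the only one missing from the condition, moves there.
  have h5 := h4.disintegrate _ hC4 hx hD'
  classical
  -- Reassembles the condition into histories: among labels not strictly below v, only v has v as a
  -- prefix.
  let i : ((NotBelow v → Fin (k + 1) → 𝓧) × ({u : Label // ¬ v <+: u} → 𝓧)) × 𝓧 →
      NotBelow v → Fin (k + 1 + 1) → 𝓧 := fun p u =>
    extendHist (p.1.1 u) (if h : v <+: u.1 then p.2 else p.1.2 ⟨u, h⟩)
  have hi : Measurable i := by
    have hq : ∀ u : NotBelow v, Measurable fun p : ((NotBelow v → Fin (k + 1) → 𝓧) ×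
        ({u : Label // ¬ v <+: u} → 𝓧)) × 𝓧 =>
        (p.1.1 u, if h : v <+: u.1 then p.2 else p.1.2 ⟨u, h⟩) := by
      intro u
      by_cases hu : v <+: u.1
      · simp only [hu, dif_pos]
        fun_prop
      · simp only [hu, dif_neg, not_false_iff]
        fun_prop
    exact measurable_pi_iff.2 fun u => measurable_extendHist.comp (hq u)
  refine h5.change_condition (hC4.prodMk hx) hD' hi (fun ω => funext fun u => ?_) fun ω => ?_
  · by_cases hu : v <+: u.1
    · have huv : u.1 = v := by
        by_contra hne
        exact u.2 ⟨hu, hne⟩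
      simp [i, huv]
    · simp [i, hu]
  · simp [Kernel.comap_apply, w', edgeState, extendHist]

end MRF

/-! ### Histories of the particle system: fresh noise and the Markov property at all times -/

section Dynamics

variable {Ω 𝓧 Ξ : Type*}

/-- The random field of the histories up to time `k`. -/
def histField {ι : Type*} (X : ι → ℕ → Ω → 𝓧) (k : ℕ) (ω : Ω) (v : ι) : Fin (k + 1) → 𝓧 :=
  hist (X v) k ω

theorem measurable_hist [MeasurableSpace Ω] [MeasurableSpace 𝓧] {x : ℕ → Ω → 𝓧}
    (hx : ∀ k, Measurable (x k)) (k : ℕ) : Measurable (hist x k) :=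
  measurable_pi_iff.2 fun i => hx i

theorem measurable_histField [MeasurableSpace Ω] [MeasurableSpace 𝓧] {ι : Type*}
    {X : ι → ℕ → Ω → 𝓧} (hX : ∀ v k, Measurable (X v k)) (k : ℕ) : Measurable (histField X k) :=
  measurable_pi_iff.2 fun v => measurable_hist (hX v) k

variable [MeasurableSpace Ω] [TopologicalSpace 𝓧] [MeasurableSpace 𝓧] [MeasurableSpace Ξ]
  {μ : Measure Ω} {ρ₀ ρ : Measure ℕ} [IsProbabilityMeasure ρ₀] [IsProbabilityMeasure ρ] {ϖ : 𝓧}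
  {F : Update 𝓧 Ξ} {ν : Measure Ξ} {T : Ω → Set Label} {X : Label → ℕ → Ω → 𝓧}
  {ξ : Label → ℕ → Ω → Ξ}

/-- The tree is almost surely encoded in the initial states, so that the field of histories carries
all information. -/
theorem GWAssumptions.ae_tree_eq (hA : GWAssumptions ρ₀ ρ ϖ F ν μ T X ξ) (k : ℕ) :
    ∀ᵐ ω ∂μ, T ω = alive ϖ (histField X k ω) := by
  filter_upwards [ae_all_iff.2 hA.cemetery_init] with ω hω
  ext v
  change v ∈ T ω ↔ X v 0 ω ≠ ϖ
  rw [Ne, hω v, not_not]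

theorem GWAssumptions.isProbabilityMeasure_noise [IsProbabilityMeasure μ]
    (hA : GWAssumptions ρ₀ ρ ϖ F ν μ T X ξ) :
    IsProbabilityMeasure ν := by
  rw [← hA.noise_law [] 0]
  exact Measure.isProbabilityMeasure_map (hA.measurable_noise [] 0).aemeasurable

theorem GWDynamics.ae_step (hA : GWAssumptions ρ₀ ρ ϖ F ν μ T X ξ) (hX : GWDynamics ϖ F μ T X ξ)
    (k : ℕ) : ∀ᵐ ω ∂μ, ∀ v, X v (k + 1) ω =
      step ϖ F (histField X k ω) (fun v => ξ v k ω) v := by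
  filter_upwards [ae_all_iff.2 fun v => hX.2 v k, hA.ae_tree_eq k] with ω hω hT v
  rw [hω v, hT]
  rfl

theorem GWDynamics.ae_histField_succ (hA : GWAssumptions ρ₀ ρ ϖ F ν μ T X ξ)
    (hX : GWDynamics ϖ F μ T X ξ) (k : ℕ) :
    histField X (k + 1) =ᵐ[μ] fun ω v =>
      extendHist (histField X k ω v) (step ϖ F (histField X k ω) (fun v => ξ v k ω) v) := by
  filter_upwards [hX.ae_step hA k] with ω hω
  ext1 v
  rw [← hω v]
  exact hist_succ _ _ _

variable [PolishSpace 𝓧] [BorelSpace 𝓧]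

/-- The histories up to time `k` are a function of the initial states and of the noise that enters
the first `k` steps. -/
theorem GWDynamics.exists_histField_eq (hA : GWAssumptions ρ₀ ρ ϖ F ν μ T X ξ)
    (hX : GWDynamics ϖ F μ T X ξ) (k : ℕ) :
    ∃ Φ : (Label → 𝓧) × ({p : Label × ℕ // p.2 < k} → Ξ) → Label → Fin (k + 1) → 𝓧,
      Measurable Φ ∧ histField X k =ᵐ[μ]
        fun ω => Φ (fun v => X v 0 ω, fun p => ξ p.1.1 p.1.2 ω) := by
  induction k with
  | zero =>
    refine ⟨fun p v _ => p.1 v, by fun_prop, ae_of_all _ fun ω => ?_⟩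
    ext v i
    obtain rfl : i = 0 := Fin.fin_one_eq_zero _
    rfl
  | succ k ih =>
    obtain ⟨Φ, hΦ, h⟩ := ih
    have hF : MeasurableUpdate F := hA.measurable_update
    let Ψ : (Label → 𝓧) × ({p : Label × ℕ // p.2 < k + 1} → Ξ) → Label → Fin (k + 1) → 𝓧 :=
      fun p => Φ (p.1, fun q => p.2 ⟨q.1, q.2.trans k.lt_succ_self⟩)
    have hΨ : Measurable Ψ := hΦ.comp (by fun_prop)
    refine ⟨fun p v => extendHist (Ψ p v)
      (step ϖ F (Ψ p) (fun v => p.2 ⟨(v, k), k.lt_succ_self⟩) v), ?_, ?_⟩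
    · have hs : Measurable fun p : (Label → 𝓧) × ({p : Label × ℕ // p.2 < k + 1} → Ξ) =>
          step ϖ F (Ψ p) (fun v => p.2 ⟨(v, k), k.lt_succ_self⟩) :=
        (measurable_step hF).comp (hΨ.prodMk (by fun_prop))
      exact measurable_pi_iff.2 fun v => measurable_extendHist.comp
        ((measurable_pi_iff.1 hΨ v).prodMk (measurable_pi_iff.1 hs v))
    · filter_upwards [h, hX.ae_histField_succ hA k] with ω h1 h2
      rw [h2, h1]

variable [IsProbabilityMeasure μ]

/-- Histories up to time k are built from the initial states and the noises with time index below k,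
whereas `ξ v k` enters only the next step. -/
theorem GWDynamics.indepFun_histField_noise (hA : GWAssumptions ρ₀ ρ ϖ F ν μ T X ξ)
    (hX : GWDynamics ϖ F μ T X ξ) (k : ℕ) :
    IndepFun (histField X k) (fun ω v => ξ v k ω) μ := by
  obtain ⟨Φ, hΦ, h⟩ := hX.exists_histField_eq hA k
  have h1 : IndepFun (fun ω (v : Label) => X v 0 ω)
      (fun ω => ((fun p : {p : Label × ℕ // p.2 < k} => ξ p.1.1 p.1.2 ω), fun v => ξ v k ω)) μ :=
    hA.indep_init_noise.comp (φ := Prod.snd) (ψ := fun e : Label × ℕ → Ξ =>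
      ((fun p : {p : Label × ℕ // p.2 < k} => e p.1), fun v : Label => e (v, k)))
      measurable_snd (by fun_prop)
  have h2 : IndepFun (fun ω (p : {p : Label × ℕ // p.2 < k}) => ξ p.1.1 p.1.2 ω)
      (fun ω v => ξ v k ω) μ :=
    indepFun_of_disjoint_range hA.noise_indep (fun p => hA.measurable_noise p.1 p.2)
      (f := fun p : {p : Label × ℕ // p.2 < k} => p.1) (g := fun v : Label => (v, k))
      fun a b hab => by have := a.2; rw [hab] at this; exact lt_irrefl _ this
  have h3 := IndepFun.assoc_of_indepFun (measurable_pi_iff.2 hA.measurable_init)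
    (measurable_pi_iff.2 fun p => hA.measurable_noise _ _)
    (measurable_pi_iff.2 fun v => hA.measurable_noise _ _) h1 h2
  exact (h3.comp hΦ measurable_id).congr h.symm (ae_eq_refl _)

/-- Conditional independence lets the states beyond the edge join the condition of the homogeneous
kernel. Since marks are almost surely functions of states, the marked kernel becomes a kernel on
states. -/
theorem GWAssumptions.exists_isConeMarkov_zero (hA : GWAssumptions ρ₀ ρ ϖ F ν μ T X ξ) :
    ∃ Λ : Kernel ((Fin (0 + 1) → 𝓧) × (Fin (0 + 1) → 𝓧)) (NonRoot → Fin (0 + 1) → 𝓧),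
      IsMarkovKernel Λ ∧ IsConeMarkov μ (histField X 0) Λ := by
  classical
  obtain ⟨Θ, hΘ⟩ := hA.homogeneous_init
  have : IsMarkovKernel Θ := (hΘ [1] (by simp)).1
  let m : 𝓧 → Prop × 𝓧 := fun x => (x ≠ ϖ, x)
  have hm : Measurable m :=
    (measurableSet_setOfPred.1 (measurableSet_singleton ϖ).compl).prodMk measurable_id
  let m₂ : (Fin (0 + 1) → 𝓧) × (Fin (0 + 1) → 𝓧) → (Prop × 𝓧) × (Prop × 𝓧) :=
    fun w => (m (w.1 0), m (w.2 0))
  have hm₂ : Measurable m₂ := (hm.comp (by fun_prop)).prodMk (hm.comp (by fun_prop))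
  let g : ((Fin (0 + 1) → 𝓧) × (Fin (0 + 1) → 𝓧)) × (NonRoot → Prop × 𝓧) →
      NonRoot → Fin (0 + 1) → 𝓧 := fun p u _ => (p.2 u).2
  have hg : Measurable g := by fun_prop
  refine ⟨pushKernel (Θ.comap m₂ hm₂) g, isMarkovKernel_pushKernel _ hg, fun v hv => ?_⟩
  have hY : ∀ u, Measurable (marked T X u) := fun u =>
    ((measurable_set_mem u).comp hA.measurable_tree).prodMk (hA.measurable_init u)
  have hbelow : ∀ u : NonRoot, v ++ u.1 ∈ below v := fun u =>
    ⟨List.prefix_append _ _, fun h => u.2 (by simpa using h)⟩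
  have hD : Measurable fun ω (u : NonRoot) => marked T X (v ++ u.1) ω :=
    measurable_pi_iff.2 fun u => hY _
  have hB : Measurable fun ω (u : beyond v) => marked T X u ω := measurable_pi_iff.2 fun u => hY _
  have hm' : ∀ u, marked T X u =ᵐ[μ] fun ω => m (X u 0 ω) := by
    intro u
    filter_upwards [hA.cemetery_init u] with ω hω
    refine Prod.ext (propext ?_) rfl
    change u ∈ T ω ↔ X u 0 ω ≠ ϖ
    rw [Ne, hω, not_not]
  have h1 := (hA.condIndep_init v hv).isCondLaw (measurable_pi_iff.2 fun u => hY _) hB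
    ((hY v).prodMk (hY v.dropLast)) (r := fun f (u : NonRoot) => f ⟨v ++ u.1, hbelow u⟩)
    (by fun_prop) (hΘ v hv)
  have h2 := h1.congr
    (C' := fun ω => ((m (X v 0 ω), m (X v.dropLast 0 ω)), fun u : beyond v => marked T X u ω))
    (D' := fun ω (u : NonRoot) => marked T X (v ++ u.1) ω)
    (by
      filter_upwards [hm' v, hm' v.dropLast] with ω h2 h3
      rw [h2, h3]) (ae_eq_refl _)
  have hC2 : Measurable fun ω => ((m (X v 0 ω), m (X v.dropLast 0 ω)),
      fun u : beyond v => marked T X u ω) :=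
    ((hm.comp (hA.measurable_init v)).prodMk (hm.comp (hA.measurable_init _))).prodMk hB
  -- The labels not strictly below v are v, its parent and those beyond the edge; the marks are
  -- forgotten.
  let i₀ : ((Prop × 𝓧) × (Prop × 𝓧)) × (beyond v → Prop × 𝓧) → NotBelow v → 𝓧 := fun p u =>
    if h : u.1 = v then p.1.1.2 else if h' : u.1 = v.dropLast then p.1.2.2 else
      (p.2 ⟨u.1, u.2, h, h'⟩).2
  have hdl : v.dropLast ≠ v := fun h => by
    have h1 := congrArg List.length h
    have h2 := List.length_pos_of_ne_nil hv
    rw [List.length_dropLast] at h1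
    omega
  have hi₀ : ∀ u, Measurable fun p => i₀ p u := by
    intro u
    by_cases h : u.1 = v
    · simp only [i₀, h, dif_pos]
      fun_prop
    · by_cases h' : u.1 = v.dropLast
      · simp only [i₀, h', hdl, dif_pos, dif_neg, not_false_iff]
        fun_prop
      · simp only [i₀, h, h', dif_neg, not_false_iff]
        fun_prop
  have h3 := h2.change_condition (C' := fun ω (u : NotBelow v) => histField X 0 ω u)
    (κ' := (Θ.comap m₂ hm₂).comap (edgeState v) (measurable_edgeState v)) hC2 hD
    (i := fun p u _ => i₀ p u)
    (measurable_pi_iff.2 fun u => measurable_pi_iff.2 fun _ => hi₀ u)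
    (fun ω => by
      ext u j
      obtain rfl : j = 0 := Fin.fin_one_eq_zero _
      change i₀ _ u = X u 0 ω
      by_cases h : u.1 = v
      · simp [i₀, h, m]
      · by_cases h' : u.1 = v.dropLast
        · simp [i₀, h', hdl, m]
        · simp [i₀, h, h', marked])
    (fun ω => rfl)
  have hC3 : Measurable fun ω (u : NotBelow v) => histField X 0 ω u := by
    refine measurable_pi_iff.2 fun u => measurable_pi_iff.2 fun j => ?_
    obtain rfl : j = 0 := Fin.fin_one_eq_zero _
    exact hA.measurable_init u
  refine (h3.push (measurable_edgeState v) hC3 hD hg).congr (ae_eq_refl _) (ae_of_all _ fun ω => ?_)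
  ext u j
  obtain rfl : j = 0 := Fin.fin_one_eq_zero _
  rfl

theorem GWDynamics.exists_isConeMarkov (hA : GWAssumptions ρ₀ ρ ϖ F ν μ T X ξ)
    (hX : GWDynamics ϖ F μ T X ξ) (k : ℕ) :
    ∃ Λ : Kernel ((Fin (k + 1) → 𝓧) × (Fin (k + 1) → 𝓧)) (NonRoot → Fin (k + 1) → 𝓧),
      IsMarkovKernel Λ ∧ IsConeMarkov μ (histField X k) Λ := by
  induction k with
  | zero => exact hA.exists_isConeMarkov_zero
  | succ k ih =>
    obtain ⟨Λ, hΛ, h⟩ := ih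
    have := hA.isProbabilityMeasure_noise
    obtain ⟨Λ', hΛ', h'⟩ := h.step (ϖ := ϖ) hA.measurable_update Λ
      (measurable_histField hX.1 k) (fun v => hA.measurable_noise v k)
      (hA.noise_indep.precomp (g := fun v => (v, k)) fun a b hab => (Prod.ext_iff.1 hab).1)
      (fun v => hA.noise_law v k) (hX.indepFun_histField_noise hA k)
    exact ⟨Λ', hΛ', h'.congr (hX.ae_histField_succ hA k).symm⟩

end Dynamics

/-! ### Homogeneous versions and conditional independence of neighborhoods -/

section Homogeneous

variable {Ω 𝓧 Ξ : Type*} [MeasurableSpace Ω] [TopologicalSpace 𝓧] [MeasurableSpace 𝓧]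
  [MeasurableSpace Ξ] {μ : Measure Ω}
  {ρ₀ ρ : Measure ℕ} [IsProbabilityMeasure ρ₀] [IsProbabilityMeasure ρ] {ϖ : 𝓧}
  {F : Update 𝓧 Ξ} {ν : Measure Ξ} {T : Ω → Set Label} {X : Label → ℕ → Ω → 𝓧}
  {ξ : Label → ℕ → Ω → Ξ}
  {γ : ∀ k : ℕ, Kernel ((Fin (k + 1) → 𝓧) × (Fin (k + 1) → 𝓧)) (UnorderedSeq (Fin (k + 1) → 𝓧))}

theorem GWAssumptions.ae_unordered_eq (hA : GWAssumptions ρ₀ ρ ϖ F ν μ T X ξ) (k : ℕ) :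
    ∀ᵐ ω ∂μ, ∀ v, unordered (fun u => hist (X u) k ω) (nbrs (T ω) v) =
      nbhd ϖ v (histField X k ω) := by
  filter_upwards [hA.ae_tree_eq k] with ω hω v
  rw [hω]
  rfl

theorem IsHomogeneousVersion.isMarkovKernel (hγ : IsHomogeneousVersion μ T X γ) (k : ℕ) :
    IsMarkovKernel (γ k) := (hγ k [1] (by simp)).1

open Classical in
/-- The indicator of the event that the neighborhood of `v` belongs to `B`, if `v` is alive. -/
noncomputable def nbhdIndicator (ϖ : 𝓧) {k : ℕ} (B : Set (UnorderedSeq (Fin (k + 1) → 𝓧)))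
    (v : Label) (s : Label → Fin (k + 1) → 𝓧) : ℝ≥0∞ :=
  if s v 0 ≠ ϖ then B.indicator 1 (nbhd ϖ v s) else 1

open Classical in
/-- The conditional probability of the event of `nbhdIndicator` at a vertex with state `w.1` and
parental state `w.2`. -/
noncomputable def edgeProb (ϖ : 𝓧) {k : ℕ}
    (κ : Kernel ((Fin (k + 1) → 𝓧) × (Fin (k + 1) → 𝓧)) (UnorderedSeq (Fin (k + 1) → 𝓧)))
    (B : Set (UnorderedSeq (Fin (k + 1) → 𝓧))) (w : (Fin (k + 1) → 𝓧) × (Fin (k + 1) → 𝓧)) :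
    ℝ≥0∞ :=
  if w.1 0 ≠ ϖ then κ w B else 1

variable [PolishSpace 𝓧] [BorelSpace 𝓧] [IsProbabilityMeasure μ]

/-- The neighborhood of v is a fixed function of the edge and of the states strictly below v, so its
kernel is an image of the cone kernel. The condition contains everything not strictly below v, which
is stronger than conditioning on the edge. -/
theorem GWDynamics.exists_nbhd_kernel (hA : GWAssumptions ρ₀ ρ ϖ F ν μ T X ξ)
    (hX : GWDynamics ϖ F μ T X ξ) (k : ℕ) :
    ∃ κ : Kernel ((Fin (k + 1) → 𝓧) × (Fin (k + 1) → 𝓧)) (UnorderedSeq (Fin (k + 1) → 𝓧)),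
      IsMarkovKernel κ ∧ ∀ v, v ≠ [] →
        IsCondLaw μ (fun ω (u : NotBelow v) => histField X k ω u)
          (fun ω => nbhd ϖ v (histField X k ω)) (κ.comap (edgeState v) (measurable_edgeState v)) := by
  obtain ⟨Λ, hΛ, h⟩ := hX.exists_isConeMarkov hA k
  let g : ((Fin (k + 1) → 𝓧) × (Fin (k + 1) → 𝓧)) × (NonRoot → Fin (k + 1) → 𝓧) →
      UnorderedSeq (Fin (k + 1) → 𝓧) := fun p => coneNbhd ϖ [] (coneState p.1 p.2)
  have hg : Measurable g := (measurable_coneNbhd ϖ []).comp measurable_coneState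
  have hm := measurable_histField hX.1 k
  refine ⟨pushKernel Λ g, isMarkovKernel_pushKernel _ hg, fun v hv => ?_⟩
  refine ((h v hv).push (measurable_edgeState v) (by fun_prop) (by fun_prop) hg).congr
    (ae_eq_refl _) (ae_of_all _ fun ω => ?_)
  have h1 := nbhd_append ϖ hv [] (histField X k ω)
  rw [List.append_nil] at h1
  simp only [h1, g]
  congr 1
  exact funext fun w => coneState_eq v (histField X k ω) w

theorem GWDynamics.exists_isHomogeneousVersion (hA : GWAssumptions ρ₀ ρ ϖ F ν μ T X ξ)
    (hX : GWDynamics ϖ F μ T X ξ) : ∃ γ, IsHomogeneousVersion μ T X γ := by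
  choose γ hγ h using hX.exists_nbhd_kernel hA
  refine ⟨γ, fun k v hv => ?_⟩
  have hm := measurable_histField hX.1 k
  refine ((h k v hv).change_condition (by fun_prop) ((measurable_nbhd ϖ v).comp hm)
    (measurable_edgeState v) (fun ω => rfl) (fun ω => rfl)).congr (ae_eq_refl _) ?_
  filter_upwards [hA.ae_unordered_eq k] with ω hω
  exact (hω v).symm

theorem measurable_nbhdIndicator {k : ℕ} {B : Set (UnorderedSeq (Fin (k + 1) → 𝓧))}
    (hB : MeasurableSet B) (v : Label) : Measurable (nbhdIndicator ϖ B v) := by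
  refine Measurable.ite ?_ ((measurable_one.indicator hB).comp (measurable_nbhd ϖ v))
    measurable_const
  exact (measurableSet_singleton ϖ).compl.preimage (by fun_prop :
    Measurable fun s : Label → Fin (k + 1) → 𝓧 => s v 0)

theorem measurable_edgeProb {k : ℕ}
    {κ : Kernel ((Fin (k + 1) → 𝓧) × (Fin (k + 1) → 𝓧)) (UnorderedSeq (Fin (k + 1) → 𝓧))}
    {B : Set (UnorderedSeq (Fin (k + 1) → 𝓧))} (hB : MeasurableSet B) :
    Measurable (edgeProb ϖ κ B) := by
  refine Measurable.ite ?_ (Kernel.measurable_coe κ hB) measurable_const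
  exact (measurableSet_singleton ϖ).compl.preimage (by fun_prop :
    Measurable fun w : (Fin (k + 1) → 𝓧) × (Fin (k + 1) → 𝓧) => w.1 0)

/-- Although `γ k` is specified only as a conditional law given the edge, it may be used against any
function of the states not strictly below v, since conditioning on these gives the same law. -/
theorem GWDynamics.lintegral_nbhdIndicator (hA : GWAssumptions ρ₀ ρ ϖ F ν μ T X ξ)
    (hX : GWDynamics ϖ F μ T X ξ) (hγ : IsHomogeneousVersion μ T X γ) {k : ℕ}
    {B : Set (UnorderedSeq (Fin (k + 1) → 𝓧))} (hB : MeasurableSet B) {v : Label} (hv : v ≠ [])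
    {f : (NotBelow v → Fin (k + 1) → 𝓧) → ℝ≥0∞} (hf : Measurable f) :
    ∫⁻ ω, f (fun u => histField X k ω u) * nbhdIndicator ϖ B v (histField X k ω) ∂μ =
      ∫⁻ ω, f (fun u => histField X k ω u) *
        edgeProb ϖ (γ k) B (histField X k ω v, histField X k ω v.dropLast) ∂μ := by
  classical
  obtain ⟨κ, hκ, h⟩ := hX.exists_nbhd_kernel hA k
  have hm := measurable_histField hX.1 k
  have hC : Measurable fun ω (u : NotBelow v) => histField X k ω u := by fun_prop
  have hN : Measurable fun ω => nbhd ϖ v (histField X k ω) := (measurable_nbhd ϖ v).comp hm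
  have hB1 : Measurable (B.indicator (1 : UnorderedSeq (Fin (k + 1) → 𝓧) → ℝ≥0∞)) :=
    measurable_one.indicator hB
  have hind : Measurable fun p : (NotBelow v → Fin (k + 1) → 𝓧) ×
      UnorderedSeq (Fin (k + 1) → 𝓧) => f p.1 *
        if (edgeState v p.1).1 0 ≠ ϖ then B.indicator 1 p.2 else 1 := by
    refine (hf.comp measurable_fst).mul (Measurable.ite ?_ (hB1.comp measurable_snd)
      measurable_const)
    exact (measurableSet_singleton ϖ).compl.preimage (by unfold edgeState; fun_prop :
      Measurable fun p : (NotBelow v → Fin (k + 1) → 𝓧) ×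
        UnorderedSeq (Fin (k + 1) → 𝓧) => (edgeState v p.1).1 0)
  -- Coarsened to the edge, `κ` is a second version of the conditional law given by `γ k`.
  have hver : ∀ᵐ ω ∂μ, κ (histField X k ω v, histField X k ω v.dropLast) B =
      γ k (histField X k ω v, histField X k ω v.dropLast) B := by
    have h1 := (h v hv).change_condition (κ' := κ) hC hN (measurable_edgeState v)
      (fun ω => rfl) (fun ω => rfl)
    have h2 := (hγ k v hv).congr (ae_eq_refl _)
      (D' := fun ω => nbhd ϖ v (histField X k ω))
      (by filter_upwards [hA.ae_unordered_eq k] with ω hω using hω v)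
    exact ae_of_ae_map ((measurable_edgeState v).comp hC).aemeasurable (h1.ae_apply_eq h2 hB)
  refine ((h v hv).lintegral_eq hC hN hind).trans (lintegral_congr_ae ?_)
  filter_upwards [hver] with ω hω
  by_cases hal : histField X k ω v 0 ≠ ϖ
  · simp only [edgeState, hal, if_true, edgeProb, ne_eq, not_false_iff]
    rw [lintegral_const_mul _ hB1, lintegral_indicator_one hB, ← hω]
    rfl
  · simp only [edgeState, hal, if_false, edgeProb, lintegral_const, measure_univ, mul_one]

/-- The vertices of generation two. -/
abbrev SecondGen : Type := {v : Label2 // v.1.length = 2}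

theorem SecondGen.ne_nil (v : SecondGen) : v.1.1 ≠ [] := fun h => by
  have := v.2
  simp [h] at this

theorem Label2.notMem_below (v : SecondGen) (u : Label2) : u.1 ∉ below v.1.1 := fun h =>
  h.2 (h.1.eq_of_length_le (u.2.trans_eq v.2.symm)).symm

theorem SecondGen.not_prefix {u v : SecondGen} (h : u ≠ v) : ¬ v.1.1 <+: u.1.1 := fun h1 =>
  h (Subtype.ext (Subtype.ext (h1.eq_of_length (v.2.trans u.2.symm)).symm))

/-- Given the states of the first two generations, the neighborhoods of the living vertices of
generation two are conditionally independent. -/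
theorem GWDynamics.lintegral_prod_nbhdIndicator (hA : GWAssumptions ρ₀ ρ ϖ F ν μ T X ξ)
    (hX : GWDynamics ϖ F μ T X ξ) (hγ : IsHomogeneousVersion μ T X γ) {k : ℕ}
    (U : Finset SecondGen) {B : SecondGen → Set (UnorderedSeq (Fin (k + 1) → 𝓧))}
    (hB : ∀ v, MeasurableSet (B v)) {f : (Label2 → Fin (k + 1) → 𝓧) → ℝ≥0∞} (hf : Measurable f) :
    ∫⁻ ω, f (fun u => histField X k ω u) *
        ∏ v ∈ U, nbhdIndicator ϖ (B v) v.1.1 (histField X k ω) ∂μ =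
      ∫⁻ ω, f (fun u => histField X k ω u) *
        ∏ v ∈ U, edgeProb ϖ (γ k) (B v) (histField X k ω v.1.1,
          histField X k ω (parent2 v.1).1) ∂μ := by
  classical
  induction U using Finset.induction_on generalizing f with
  | empty => simp
  | insert v U hv ih =>
    -- The factors of the other vertices do not read anything strictly below v, because their own
    -- cones are disjoint from that of v. So v can be integrated out first.
    let h : (NotBelow v.1.1 → Fin (k + 1) → 𝓧) → ℝ≥0∞ := fun c =>
      f (fun u => fillBelow v.1.1 c u) *
        ∏ u ∈ U, nbhdIndicator ϖ (B u) u.1.1 (fillBelow v.1.1 c)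
    have hh : Measurable h := by
      have hfb := measurable_fillBelow (S := Fin (k + 1) → 𝓧) v.1.1
      refine (hf.comp (by fun_prop)).mul (Finset.measurable_prod _ fun u _ => ?_)
      exact (measurable_nbhdIndicator (hB u) _).comp hfb
    have heq : ∀ ω, h (fun u => histField X k ω u) = f (fun u => histField X k ω u) *
        ∏ u ∈ U, nbhdIndicator ϖ (B u) u.1.1 (histField X k ω) := by
      intro ω
      simp only [h]
      congr 1
      · congr 1
        exact funext fun u => fillBelow_apply (Label2.notMem_below v u) _
      · refine Finset.prod_congr rfl fun u hu => ?_
        have hne : u ≠ v := fun huv => hv (huv ▸ hu)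
        have e1 : fillBelow v.1.1 (fun u : NotBelow v.1.1 => histField X k ω u) u.1.1 =
            histField X k ω u.1.1 := fillBelow_apply (Label2.notMem_below v u.1) _
        rw [nbhdIndicator, nbhdIndicator, e1, nbhd_congr ϖ e1 fun u' hu' =>
          fillBelow_apply (notMem_below_of_adj (SecondGen.not_prefix hne) hu') _]
    have key := hX.lintegral_nbhdIndicator hA hγ (hB v) v.ne_nil hh
    simp only [heq] at key
    -- The probability produced at v depends on the first two generations only, so it is absorbed
    -- into the test function of the induction hypothesis.
    let f' : (Label2 → Fin (k + 1) → 𝓧) → ℝ≥0∞ := fun s =>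
      f s * edgeProb ϖ (γ k) (B v) (s v.1, s (parent2 v.1))
    have hf' : Measurable f' := hf.mul ((measurable_edgeProb (hB v)).comp (by fun_prop))
    calc _ = _ := lintegral_congr fun ω => by
            rw [Finset.prod_insert hv, mul_comm (nbhdIndicator _ _ _ _), ← mul_assoc]
      _ = _ := key
      _ = ∫⁻ ω, f' (fun u => histField X k ω u) *
            ∏ u ∈ U, nbhdIndicator ϖ (B u) u.1.1 (histField X k ω) ∂μ :=
          lintegral_congr fun ω => mul_right_comm _ _ _
      _ = _ := ih hf'
      _ = _ := lintegral_congr fun ω => by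
            rw [Finset.prod_insert hv, ← mul_assoc]

end Homogeneous

/-! ### The particle system restricted to two generations is a local-field process -/

section Phantom

theorem measurableSet_phantom {S : Type*} [MeasurableSpace S] (U : Finset SecondGen)
    {B : SecondGen → Set S} {Ω : Type*} [MeasurableSpace Ω] {T : Ω → Set Label}
    {Z : SecondGen → Ω → S} (hT : Measurable T)
    (hZ : ∀ v, Measurable (Z v)) (hB : ∀ v, MeasurableSet (B v)) :
    MeasurableSet {ω | ∀ v ∈ U, v.1.1 ∈ T ω → Z v ω ∈ B v} := by
  have h : {ω | ∀ v ∈ U, v.1.1 ∈ T ω → Z v ω ∈ B v} =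
      ⋂ v ∈ U, ({ω | v.1.1 ∈ T ω}ᶜ ∪ Z v ⁻¹' B v) := by
    ext ω
    simp [imp_iff_not_or]
  rw [h]
  exact Finset.measurableSet_biInter _ fun v _ =>
    (measurableSet_setOfPred.2 ((measurable_set_mem _).comp hT)).compl.union (hZ v (hB v))

variable {𝓧 : Type*} [TopologicalSpace 𝓧] [MeasurableSpace 𝓧] {k : ℕ}

open Classical in
/-- The conditional probability that the phantom particles at the vertices `v ∈ U` of the tree
belong to the sets `B v`, given the tree and the histories. -/
noncomputable def phantomProb
    (κ : Kernel ((Fin (k + 1) → 𝓧) × (Fin (k + 1) → 𝓧)) (UnorderedSeq (Fin (k + 1) → 𝓧)))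
    (U : Finset SecondGen) (B : SecondGen → Set (UnorderedSeq (Fin (k + 1) → 𝓧)))
    (p : Set Label × (Label2 → Fin (k + 1) → 𝓧)) : ℝ :=
  ∏ v ∈ U, if v.1.1 ∈ p.1 then (κ (p.2 v.1, p.2 (parent2 v.1))).real (B v) else 1

variable (κ : Kernel ((Fin (k + 1) → 𝓧) × (Fin (k + 1) → 𝓧)) (UnorderedSeq (Fin (k + 1) → 𝓧)))
  (U : Finset SecondGen) {B : SecondGen → Set (UnorderedSeq (Fin (k + 1) → 𝓧))}

theorem measurable_phantomProb (hB : ∀ v, MeasurableSet (B v)) :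
    Measurable (phantomProb κ U B) := by
  refine Finset.measurable_prod _ fun v _ => Measurable.ite ?_ ?_ measurable_const
  · exact measurableSet_setOfPred.2 ((measurable_set_mem _).comp measurable_fst)
  · have h : Measurable fun w => (κ w).real (B v) := (Kernel.measurable_coe κ (hB v)).ennreal_toReal
    exact h.comp (by fun_prop : Measurable fun p : Set Label × (Label2 → Fin (k + 1) → 𝓧) =>
      (p.2 v.1, p.2 (parent2 v.1)))

theorem phantomProb_nonneg (p : Set Label × (Label2 → Fin (k + 1) → 𝓧)) :
    0 ≤ phantomProb κ U B p :=
  Finset.prod_nonneg fun v _ => by split_ifs <;> positivity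

theorem phantomProb_le_one [IsMarkovKernel κ] (p : Set Label × (Label2 → Fin (k + 1) → 𝓧)) :
    phantomProb κ U B p ≤ 1 := by
  refine Finset.prod_le_one (fun v _ => by split_ifs <;> positivity) fun v _ => ?_
  split_ifs
  · exact measureReal_le_one
  · exact le_rfl

theorem integrable_phantomProb [IsMarkovKernel κ] {Ω : Type*} [MeasurableSpace Ω] {μ : Measure Ω}
    [IsFiniteMeasure μ] {R : Ω → Set Label × (Label2 → Fin (k + 1) → 𝓧)} (hR : Measurable R)
    (hB : ∀ v, MeasurableSet (B v)) : Integrable (fun ω => phantomProb κ U B (R ω)) μ := by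
  refine Integrable.of_bound ((measurable_phantomProb κ U hB).comp hR).aestronglyMeasurable 1
    (ae_of_all _ fun ω => ?_)
  rw [Real.norm_of_nonneg (phantomProb_nonneg κ U _)]
  exact phantomProb_le_one κ U _

end Phantom

section Restriction

variable {Ω 𝓧 Ξ : Type*}

/-- Up to generation one all neighbors have generation at most two, so the truncation loses none. -/
theorem nbrHist2_restrict (T : Ω → Set Label) (X : Label → ℕ → Ω → 𝓧) {v : Label2}
    (hv : v.1.length ≤ 1) (k : ℕ) (ω : Ω) :
    nbrHist2 (fun ω => T ω ∩ firstTwoGenerations) (fun v : Label2 => X v.1) v k ω =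
      unordered (fun u => hist (X u) k ω) (nbrs (T ω) v.1) := by
  rw [nbrHist2, ← unordered_image Subtype.val_injective (fun u => hist (X u) k ω)]
  congr 1
  ext u
  simp only [Set.mem_image, Set.mem_ofPred_eq, mem_nbrs_iff, Set.mem_inter_iff]
  constructor
  · rintro ⟨u, ⟨h1, h2, h3⟩, rfl⟩
    exact ⟨h1.1, h2.1, h3⟩
  · rintro ⟨h1, h2, h3⟩
    have hu : u.length ≤ 2 := by
      rcases h3 with ⟨j, hj⟩ | ⟨j, hj⟩
      · have := congrArg List.length hj
        simp at this
        omega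
      · simp [hj, hv]
    exact ⟨⟨u, hu⟩, ⟨⟨h1, hu⟩, ⟨h2, v.2⟩, h3⟩, rfl⟩

variable [MeasurableSpace Ω] [TopologicalSpace 𝓧] [MeasurableSpace 𝓧]
  [MeasurableSpace Ξ] [PolishSpace 𝓧] [BorelSpace 𝓧] {μ : Measure Ω} [IsProbabilityMeasure μ]
  {ρ₀ ρ : Measure ℕ} [IsProbabilityMeasure ρ₀] [IsProbabilityMeasure ρ] {ϖ : 𝓧}
  {F : Update 𝓧 Ξ} {ν : Measure Ξ} {T : Ω → Set Label} {X : Label → ℕ → Ω → 𝓧}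
  {ξ : Label → ℕ → Ω → Ξ}
  {γ : ∀ k : ℕ, Kernel ((Fin (k + 1) → 𝓧) × (Fin (k + 1) → 𝓧)) (UnorderedSeq (Fin (k + 1) → 𝓧))}

/-- This is `GWDynamics.lintegral_prod_nbhdIndicator` with the indicator of a conditioning event as
test function. Adding the truncated tree to the condition costs nothing, because it is almost surely
a function of the histories. -/
theorem GWDynamics.condExp_phantom (hA : GWAssumptions ρ₀ ρ ϖ F ν μ T X ξ)
    (hX : GWDynamics ϖ F μ T X ξ) (hγ : IsHomogeneousVersion μ T X γ) (k : ℕ)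
    (U : Finset SecondGen) {B : SecondGen → Set (UnorderedSeq (Fin (k + 1) → 𝓧))}
    (hB : ∀ v, MeasurableSet (B v)) {R : Ω → Set Label × (Label2 → Fin (k + 1) → 𝓧)}
    (hR : R = fun ω => (T ω ∩ firstTwoGenerations, fun v : Label2 => hist (X v.1) k ω)) :
    condExp (MeasurableSpace.comap R inferInstance) μ
        ({ω | ∀ v ∈ U, v.1.1 ∈ T ω ∩ firstTwoGenerations →
          unordered (fun u => hist (X u) k ω) (nbrs (T ω) v.1.1) ∈ B v}.indicator
            fun _ => (1 : ℝ)) =ᵐ[μ] fun ω => phantomProb (γ k) U B (R ω) := by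
  classical
  have hγk := hγ.isMarkovKernel k
  have hm := measurable_histField hX.1 k
  have hT' : Measurable fun ω => T ω ∩ firstTwoGenerations :=
    measurable_set_iff.2 fun v => ((measurable_set_mem v).comp hA.measurable_tree).and
      measurable_const
  have hRm : Measurable R := by
    rw [hR]
    exact hT'.prodMk (measurable_pi_iff.2 fun v => measurable_hist (hX.1 v.1) k)
  have hZ : ∀ v : SecondGen, Measurable fun ω =>
      unordered (fun u => hist (X u) k ω) (nbrs (T ω) v.1.1) := fun v =>
    measurable_unordered.comp (((measurable_nbrs _).comp hA.measurable_tree).prodMk hm)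
  have hE := measurableSet_phantom U hT' hZ hB
  set E := {ω | ∀ v ∈ U, v.1.1 ∈ T ω ∩ firstTwoGenerations →
    unordered (fun u => hist (X u) k ω) (nbrs (T ω) v.1.1) ∈ B v}
  refine (ae_eq_condExp_of_forall_setIntegral_eq hRm.comap_le
    ((integrable_const (1 : ℝ)).indicator hE)
    (fun s _ _ => (integrable_phantomProb (γ k) U hRm hB).integrableOn) ?_
    (((measurable_phantomProb (γ k) U hB).comp
      (comap_measurable R)).stronglyMeasurable.aestronglyMeasurable)).symm
  rintro _ ⟨A, hA', rfl⟩ -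
  rw [integral_indicator hE, setIntegral_const, smul_eq_mul, mul_one,
    measureReal_restrict_apply' (hRm hA'),
    integral_eq_lintegral_of_nonneg_ae (ae_of_all _ fun ω => phantomProb_nonneg _ _ _)
      ((measurable_phantomProb (γ k) U hB).comp hRm).aestronglyMeasurable]
  rw [Measure.real]
  congr 1
  let tree : (Label2 → Fin (k + 1) → 𝓧) → Set Label := fun s =>
    {u | ∃ h : u.length ≤ 2, s ⟨u, h⟩ 0 ≠ ϖ}
  have htree : Measurable tree := by
    refine measurable_set_iff.2 fun u => ?_
    by_cases h : u.length ≤ 2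
    · simp only [tree, Set.mem_ofPred_eq, h, exists_true_left]
      exact measurableSet_setOfPred.1 ((measurableSet_singleton ϖ).compl.preimage (by fun_prop :
        Measurable fun s : Label2 → Fin (k + 1) → 𝓧 => s ⟨u, h⟩ 0))
    · simp only [tree, Set.mem_ofPred_eq, h, IsEmpty.exists_iff]
      exact measurable_const
  let f : (Label2 → Fin (k + 1) → 𝓧) → ℝ≥0∞ := fun s => A.indicator 1 (tree s, s)
  have hf : Measurable f := (measurable_one.indicator hA').comp (htree.prodMk measurable_id)
  have hR' : ∀ᵐ ω ∂μ, R ω = (tree fun v => histField X k ω v,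
      fun v : Label2 => histField X k ω v) := by
    filter_upwards [hA.ae_tree_eq k] with ω hω
    simp only [hR, hω]
    refine Prod.ext (Set.ext fun u => ?_) rfl
    exact ⟨fun h => ⟨h.2, h.1⟩, fun ⟨h1, h2⟩ => ⟨h2, h1⟩⟩
  have key := hX.lintegral_prod_nbhdIndicator hA hγ U hB hf
  have hal : ∀ (ω : Ω) (v : SecondGen), v.1.1 ∈ tree (fun v => histField X k ω v) ↔
      histField X k ω v.1.1 0 ≠ ϖ := fun ω v => ⟨fun ⟨_, h⟩ => h, fun h => ⟨v.1.2, h⟩⟩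
  calc _ = ∫⁻ ω, f (fun u => histField X k ω u) *
        ∏ v ∈ U, edgeProb ϖ (γ k) (B v) (histField X k ω v.1.1,
          histField X k ω (parent2 v.1).1) ∂μ := by
        rw [← lintegral_indicator (hRm hA')]
        refine lintegral_congr_ae ?_
        filter_upwards [hR'] with ω hω
        by_cases hωA : R ω ∈ A
        · rw [Set.indicator_of_mem (show ω ∈ R ⁻¹' A from hωA)]
          simp only [f, ← hω, Set.indicator_of_mem hωA, Pi.one_apply, one_mul]
          rw [hω, phantomProb, ENNReal.ofReal_prod_of_nonneg
            fun v _ => by split_ifs <;> positivity]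
          refine Finset.prod_congr rfl fun v _ => ?_
          simp only [hal, edgeProb]
          split_ifs
          · exact ENNReal.ofReal_toReal (measure_ne_top _ _)
          · exact ENNReal.ofReal_one
        · rw [Set.indicator_of_notMem (show ω ∉ R ⁻¹' A from hωA)]
          simp only [f, ← hω, Set.indicator_of_notMem hωA, zero_mul]
    _ = _ := key.symm
    _ = _ := by
        rw [← lintegral_indicator_one (hE.inter (hRm hA'))]
        refine lintegral_congr_ae ?_
        filter_upwards [hR', hA.ae_unordered_eq k, hA.ae_tree_eq k] with ω hω hun htr
        have hEω : ω ∈ E ↔ ∀ v ∈ U, histField X k ω v.1.1 0 ≠ ϖ →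
            nbhd ϖ v.1.1 (histField X k ω) ∈ B v := by
          refine forall₂_congr fun v _ => ?_
          rw [hun, htr]
          exact imp_congr ⟨fun h => h.1, fun h => ⟨h, v.1.2⟩⟩ Iff.rfl
        by_cases hωA : R ω ∈ A
        · simp only [f, ← hω, Set.indicator_of_mem hωA, Pi.one_apply, one_mul]
          by_cases hωE : ω ∈ E
          · rw [Set.indicator_of_mem (show ω ∈ E ∩ R ⁻¹' A from ⟨hωE, hωA⟩)]
            refine Finset.prod_eq_one fun v hv => ?_
            unfold nbhdIndicator
            split_ifs with h
            · exact Set.indicator_of_mem (hEω.1 hωE v hv h) _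
            · rfl
          · rw [Set.indicator_of_notMem fun h => hωE h.1]
            rw [hEω] at hωE
            push Not at hωE
            obtain ⟨v, hv, h1, h2⟩ := hωE
            refine Finset.prod_eq_zero hv ?_
            rw [nbhdIndicator, if_pos h1, Set.indicator_of_notMem h2]
        · rw [Set.indicator_of_notMem fun h => hωA h.2]
          simp only [f, ← hω, Set.indicator_of_notMem hωA, zero_mul]

/-- The particle system, restricted to the first two generations, is a local-field process whose
phantom particles are the actual neighborhoods of the vertices of generation two. -/
theorem GWDynamics.isLocalFieldProcess (hA : GWAssumptions ρ₀ ρ ϖ F ν μ T X ξ)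
    (hX : GWDynamics ϖ F μ T X ξ) (hγ : IsHomogeneousVersion μ T X γ) :
    IsLocalFieldProcess ϖ F ν (initLaw2 μ T X) γ μ (fun ω => T ω ∩ firstTwoGenerations)
      (fun v => X v.1) (fun v => ξ v.1)
      (fun k v ω => unordered (fun u => hist (X u) k ω) (nbrs (T ω) v.1.1)) where
  measurable_tree := measurable_set_iff.2 fun v =>
    ((measurable_set_mem v).comp hA.measurable_tree).and measurable_const
  measurable_state v k := hX.1 v.1 k
  measurable_noise v k := hA.measurable_noise v.1 k
  measurable_phantom k v := measurable_unordered.comp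
    (((measurable_nbrs _).comp hA.measurable_tree).prodMk (measurable_histField hX.1 k))
  init_law := rfl
  kernel_spec k := by
    -- The edge between 1 and the root is one of the edges covered by homogeneity.
    refine (hγ k [1] (by simp)).congr (ae_eq_refl _) (ae_of_all _ fun ω => ?_)
    exact (nbrHist2_restrict T X (v := one2) (by simp [one2]) k ω).symm
  noise_indep k := hA.noise_indep.precomp (g := fun v : Label2 => (v.1, k)) fun a b hab =>
    Subtype.ext (Prod.ext_iff.1 hab).1
  noise_law v k := hA.noise_law v.1 k
  noise_fresh k := by
    -- Tree, histories and phantom particles are almost surely functions of the full field of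
    -- histories, which is independent of the noise of this step.
    have hφ : Measurable fun s : Label → Fin (k + 1) → 𝓧 =>
        ((alive ϖ s ∩ firstTwoGenerations, fun v : Label2 => s v.1),
          fun v : SecondGen => nbhd ϖ v.1.1 s) := by
      refine Measurable.prodMk (Measurable.prodMk ?_ (by fun_prop))
        (measurable_pi_iff.2 fun v => measurable_nbhd ϖ _)
      exact measurable_set_iff.2 fun v =>
        ((measurable_set_mem v).comp (measurable_alive ϖ)).and measurable_const
    have h := (hX.indepFun_histField_noise hA k).comp
      (ψ := fun e (v : Label2) => e v.1) hφ (by fun_prop)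
    refine h.congr ?_ (ae_eq_refl _)
    filter_upwards [hA.ae_tree_eq k, hA.ae_unordered_eq k] with ω h1 h2
    simp only [Function.comp, h2]
    rw [h1]
    rfl
  phantom_law k U B hB := hX.condExp_phantom hA hγ k U hB rfl
  step_inner v k hv := by
    filter_upwards [hX.2 v.1 k] with ω hω
    rw [hω, nbrHist2_restrict T X hv]
    by_cases h : v.1 ∈ T ω
    · rw [if_pos h, if_pos ⟨h, v.2⟩]
    · rw [if_neg h, if_neg fun h' => h h'.1]
  step_outer v k := by
    filter_upwards [hX.2 v.1.1 k] with ω hω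
    rw [hω]
    by_cases h : v.1.1 ∈ T ω
    · rw [if_pos h, if_pos ⟨h, v.1.2⟩]
    · rw [if_neg h, if_neg fun h' => h h'.1]

end Restriction

/-! ### Uniqueness in law of local-field processes -/

section Uniqueness

variable {Ω Ω₁ Ω₂ 𝓧 Ξ : Type*}

/-- The tree and the histories up to time `k`. -/
def treeHist (T : Ω → Set Label) (X : Label2 → ℕ → Ω → 𝓧) (k : ℕ) (ω : Ω) :
    Set Label × (Label2 → Fin (k + 1) → 𝓧) :=
  (T ω, fun v => hist (X v) k ω)

open Classical in
/-- The phantom particles, set to the empty sequence at vertices outside of the tree. -/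
noncomputable def maskedPhantom {k : ℕ} (t : Set Label)
    (z : SecondGen → UnorderedSeq (Fin (k + 1) → 𝓧)) (v : SecondGen) :
    UnorderedSeq (Fin (k + 1) → 𝓧) :=
  if v.1.1 ∈ t then z v else UnorderedSeq.ofTuple 0 Fin.elim0

/-- The unordered sequence of the histories of the neighbors of `v` within two generations. -/
noncomputable def innerNbhd {k : ℕ} (v : Label2)
    (p : Set Label × (Label2 → Fin (k + 1) → 𝓧)) : UnorderedSeq (Fin (k + 1) → 𝓧) :=
  unordered p.2 {u : Label2 | u.1 ∈ nbrs p.1 v.1}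

theorem treeHist_zero (T : Ω → Set Label) (X : Label2 → ℕ → Ω → 𝓧) :
    treeHist T X 0 = (fun p : Set Label × (Label2 → 𝓧) => (p.1, fun v (_ : Fin (0 + 1)) => p.2 v)) ∘
      fun ω => (T ω, fun v => X v 0 ω) := by
  refine funext fun ω => Prod.ext rfl ?_
  ext v j
  obtain rfl : j = 0 := Fin.fin_one_eq_zero _
  rfl

/-- A cylinder event for the masked particles splits into the event of `phantom_law` and a condition
on the tree alone: at the absent vertices of `U`, the default value must lie in the prescribed set.
-/
theorem preimage_maskedPhantom_inter {k : ℕ} (T : Ω → Set Label) (X : Label2 → ℕ → Ω → 𝓧)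
    (Z : SecondGen → Ω → UnorderedSeq (Fin (k + 1) → 𝓧)) (U : Finset SecondGen)
    (B : SecondGen → Set (UnorderedSeq (Fin (k + 1) → 𝓧)))
    (A : Set (Set Label × (Label2 → Fin (k + 1) → 𝓧))) :
    (fun ω => maskedPhantom (T ω) fun v => Z v ω) ⁻¹' (U : Set SecondGen).pi B ∩
        treeHist T X k ⁻¹' A =
      {ω | ∀ v ∈ U, v.1.1 ∈ T ω → Z v ω ∈ B v} ∩ treeHist T X k ⁻¹'
        ({p | ∀ v ∈ U, v.1.1 ∉ p.1 → UnorderedSeq.ofTuple 0 Fin.elim0 ∈ B v} ∩ A) := by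
  ext ω
  simp only [Set.mem_inter_iff, Set.mem_preimage, Set.mem_pi, Finset.mem_coe,
    Set.mem_ofPred_eq, treeHist, maskedPhantom, ← and_assoc, ← forall₂_and]
  refine and_congr (forall₂_congr fun v _ => ?_) Iff.rfl
  by_cases hv : v.1.1 ∈ T ω <;> simp [hv]

open Classical in
/-- One step of the local-field dynamics. -/
noncomputable def fieldStep (ϖ : 𝓧) (F : Update 𝓧 Ξ) {k : ℕ}
    (p : (Set Label × (Label2 → Fin (k + 1) → 𝓧)) × (SecondGen → UnorderedSeq (Fin (k + 1) → 𝓧)))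
    (e : Label2 → Ξ) (v : Label2) : 𝓧 :=
  if v.1 ∈ p.1.1 then
    F k (p.1.2 v) (if h : v.1.length = 2 then p.2 ⟨v, h⟩ else innerNbhd v p.1) (e v)
  else ϖ

theorem measurable_maskedPhantom [TopologicalSpace 𝓧] {k : ℕ} :
    Measurable fun p : Set Label × (SecondGen → UnorderedSeq (Fin (k + 1) → 𝓧)) =>
      maskedPhantom p.1 p.2 :=
  measurable_pi_iff.2 fun v => Measurable.ite
    (measurableSet_setOfPred.2 ((measurable_set_mem _).comp measurable_fst)) (by fun_prop)
    measurable_const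

variable [MeasurableSpace Ω] [MeasurableSpace Ω₁] [MeasurableSpace Ω₂] [MeasurableSpace 𝓧]
  [MeasurableSpace Ξ]

theorem measurable_treeHist {T : Ω → Set Label} {X : Label2 → ℕ → Ω → 𝓧} (hT : Measurable T)
    (hX : ∀ v k, Measurable (X v k)) (k : ℕ) : Measurable (treeHist T X k) :=
  hT.prodMk (measurable_histField hX k)

variable [TopologicalSpace 𝓧]

theorem measurable_innerNbhd [SecondCountableTopology 𝓧] [BorelSpace 𝓧] {k : ℕ} (v : Label2) :
    Measurable (innerNbhd (𝓧 := 𝓧) (k := k) v) := by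
  refine measurable_unordered.comp (Measurable.prodMk (measurable_set_iff.2 fun u => ?_)
    measurable_snd)
  exact (measurable_set_mem u.1).comp ((measurable_nbrs v.1).comp measurable_fst)

theorem measurable_fieldStep [SecondCountableTopology 𝓧] [BorelSpace 𝓧] {ϖ : 𝓧} {F : Update 𝓧 Ξ}
    (hF : MeasurableUpdate F) {k : ℕ} :
    Measurable fun q : ((Set Label × (Label2 → Fin (k + 1) → 𝓧)) ×
      (SecondGen → UnorderedSeq (Fin (k + 1) → 𝓧))) × (Label2 → Ξ) =>
      fieldStep ϖ F q.1 q.2 := by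
  refine measurable_pi_iff.2 fun v => Measurable.ite (measurableSet_setOfPred.2
    ((measurable_set_mem _).comp measurable_fst.fst.fst)) ?_ measurable_const
  have hz : Measurable fun q : ((Set Label × (Label2 → Fin (k + 1) → 𝓧)) ×
      (SecondGen → UnorderedSeq (Fin (k + 1) → 𝓧))) × (Label2 → Ξ) =>
      if h : v.1.length = 2 then q.1.2 ⟨v, h⟩ else innerNbhd v q.1.1 := by
    by_cases h : v.1.length = 2
    · simp only [dif_pos h]
      fun_prop
    · simp only [dif_neg h]
      exact (measurable_innerNbhd v).comp measurable_fst.fst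
  exact (hF k).comp (Measurable.prodMk (by fun_prop) (hz.prodMk (by fun_prop)))

variable {ϖ : 𝓧} {F : Update 𝓧 Ξ} {ν : Measure Ξ} {μ₀ : Measure (Set Label × (Label2 → 𝓧))}
  {γ γ₁ γ₂ : ∀ k : ℕ, Kernel ((Fin (k + 1) → 𝓧) × (Fin (k + 1) → 𝓧))
    (UnorderedSeq (Fin (k + 1) → 𝓧))}
  {P : Measure Ω} {T : Ω → Set Label} {X : Label2 → ℕ → Ω → 𝓧}
  {ξ : Label2 → ℕ → Ω → Ξ} {Z : ∀ k : ℕ, SecondGen → Ω → UnorderedSeq (Fin (k + 1) → 𝓧)}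
  {P₁ : Measure Ω₁} [IsProbabilityMeasure P₁] {T₁ : Ω₁ → Set Label} {X₁ : Label2 → ℕ → Ω₁ → 𝓧}
  {ξ₁ : Label2 → ℕ → Ω₁ → Ξ} {Z₁ : ∀ k : ℕ, SecondGen → Ω₁ → UnorderedSeq (Fin (k + 1) → 𝓧)}
  {P₂ : Measure Ω₂} [IsProbabilityMeasure P₂] {T₂ : Ω₂ → Set Label} {X₂ : Label2 → ℕ → Ω₂ → 𝓧}
  {ξ₂ : Label2 → ℕ → Ω₂ → Ξ} {Z₂ : ∀ k : ℕ, SecondGen → Ω₂ → UnorderedSeq (Fin (k + 1) → 𝓧)}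

namespace IsLocalFieldProcess

/-- The integrated form of `phantom_law`; the right-hand side involves only the kernel and the law
of tree and histories. -/
theorem measure_phantom [IsProbabilityMeasure P] (h : IsLocalFieldProcess ϖ F ν μ₀ γ P T X ξ Z) (k : ℕ)
    (U : Finset SecondGen) {B : SecondGen → Set (UnorderedSeq (Fin (k + 1) → 𝓧))}
    (hB : ∀ v, MeasurableSet (B v)) {A : Set (Set Label × (Label2 → Fin (k + 1) → 𝓧))}
    (hA : MeasurableSet A) :
    P ({ω | ∀ v ∈ U, v.1.1 ∈ T ω → Z k v ω ∈ B v} ∩ treeHist T X k ⁻¹' A) =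
      ENNReal.ofReal (∫ p in A, phantomProb (γ k) U B p ∂P.map (treeHist T X k)) := by
  have hR := measurable_treeHist h.measurable_tree h.measurable_state k
  have hE := measurableSet_phantom U h.measurable_tree (h.measurable_phantom k) hB
  have h1 := h.phantom_law k U B hB
  have h2 := setIntegral_condExp (μ := P) hR.comap_le
    ((integrable_const (1 : ℝ)).indicator hE) ⟨A, hA, rfl⟩
  rw [integral_indicator hE, setIntegral_const, smul_eq_mul, mul_one,
    measureReal_restrict_apply' (hR hA)] at h2
  rw [setIntegral_map hA (measurable_phantomProb (γ k) U hB).aestronglyMeasurable hR.aemeasurable,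
    ← ofReal_measureReal, ← h2]
  congr 1
  exact integral_congr_ae (ae_restrict_of_ae h1)

/-- Phantom particles outside the tree are unconstrained, so only the masked ones have a determined
law; accordingly the kernels need to agree only at vertices in the tree. -/
theorem map_maskedPhantom_eq (h₁ : IsLocalFieldProcess ϖ F ν μ₀ γ₁ P₁ T₁ X₁ ξ₁ Z₁)
    (h₂ : IsLocalFieldProcess ϖ F ν μ₀ γ₂ P₂ T₂ X₂ ξ₂ Z₂) {k : ℕ}
    (hk : P₁.map (treeHist T₁ X₁ k) = P₂.map (treeHist T₂ X₂ k))
    (hγ : ∀ (v : SecondGen) (B : Set (UnorderedSeq (Fin (k + 1) → 𝓧))), MeasurableSet B →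
      ∀ᵐ p ∂P₂.map (treeHist T₂ X₂ k), v.1.1 ∈ p.1 →
        γ₁ k (p.2 v.1, p.2 (parent2 v.1)) B = γ₂ k (p.2 v.1, p.2 (parent2 v.1)) B) :
    P₁.map (fun ω => (treeHist T₁ X₁ k ω, maskedPhantom (T₁ ω) fun v => Z₁ k v ω)) =
      P₂.map (fun ω => (treeHist T₂ X₂ k ω, maskedPhantom (T₂ ω) fun v => Z₂ k v ω)) := by
  have hR₁ := measurable_treeHist h₁.measurable_tree h₁.measurable_state k
  have hR₂ := measurable_treeHist h₂.measurable_tree h₂.measurable_state k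
  have hM₁ : Measurable fun ω => maskedPhantom (T₁ ω) fun v => Z₁ k v ω :=
    measurable_maskedPhantom.comp (h₁.measurable_tree.prodMk
      (measurable_pi_iff.2 (h₁.measurable_phantom k)))
  have hM₂ : Measurable fun ω => maskedPhantom (T₂ ω) fun v => Z₂ k v ω :=
    measurable_maskedPhantom.comp (h₂.measurable_tree.prodMk
      (measurable_pi_iff.2 (h₂.measurable_phantom k)))
  refine Measure.ext_prod fun {A B} hA hB => ?_
  -- For each history event `A` the particles are compared under the restricted measures, by the
  -- π-system of finite-dimensional cylinders.
  have key : (P₁.restrict (treeHist T₁ X₁ k ⁻¹' A)).map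
      (fun ω => maskedPhantom (T₁ ω) fun v => Z₁ k v ω) =
      (P₂.restrict (treeHist T₂ X₂ k ⁻¹' A)).map
        (fun ω => maskedPhantom (T₂ ω) fun v => Z₂ k v ω) := by
    refine ext_of_generate_finite _ generateFrom_squareCylinders.symm
      (isPiSystem_squareCylinders (fun _ => MeasurableSpace.isPiSystem_measurableSet)
        fun _ => by simp) ?_ ?_
    · rintro _ ⟨U, B, hB, rfl⟩
      have hB' : ∀ v, MeasurableSet (B v) := fun v => hB v (Set.mem_univ v)
      let A₀ : Set (Set Label × (Label2 → Fin (k + 1) → 𝓧)) :=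
        {p | ∀ v ∈ U, v.1.1 ∉ p.1 → UnorderedSeq.ofTuple 0 Fin.elim0 ∈ B v}
      have hA₀ : MeasurableSet A₀ := by
        have h3 : A₀ = ⋂ v ∈ U, ({p | v.1.1 ∈ p.1} ∪
            {_p | UnorderedSeq.ofTuple 0 Fin.elim0 ∈ B v}) := by
          ext p
          simp [A₀, or_iff_not_imp_left]
        rw [h3]
        exact Finset.measurableSet_biInter _ fun v _ => (measurableSet_setOfPred.2
          ((measurable_set_mem _).comp measurable_fst)).union (MeasurableSet.const _)
      have hcyl : MeasurableSet ((U : Set SecondGen).pi B) :=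
        MeasurableSet.pi U.countable_toSet fun v _ => hB' v
      rw [Measure.map_apply hM₁ hcyl, Measure.map_apply hM₂ hcyl,
        Measure.restrict_apply (hM₁ hcyl), Measure.restrict_apply (hM₂ hcyl)]
      rw [preimage_maskedPhantom_inter, preimage_maskedPhantom_inter, h₁.measure_phantom k U hB' (hA₀.inter hA),
        h₂.measure_phantom k U hB' (hA₀.inter hA), hk]
      congr 1
      refine integral_congr_ae (ae_restrict_of_ae ?_)
      filter_upwards [(Filter.eventually_all_finset U).2 fun v _ => hγ v (B v) (hB' v)] with p hp
      refine Finset.prod_congr rfl fun v hv => ?_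
      split_ifs with h3
      · rw [Measure.real, Measure.real, hp v hv h3]
      · rfl
    · rw [Measure.map_apply hM₁ .univ, Measure.map_apply hM₂ .univ, Set.preimage_univ,
        Set.preimage_univ, Measure.restrict_apply_univ, Measure.restrict_apply_univ,
        ← Measure.map_apply hR₁ hA, ← Measure.map_apply hR₂ hA, hk]
  have key' := congrArg (fun m => m B) key
  rw [Measure.map_apply hM₁ hB, Measure.map_apply hM₂ hB, Measure.restrict_apply (hM₁ hB),
    Measure.restrict_apply (hM₂ hB), Set.inter_comm, Set.inter_comm _ (_ ⁻¹' A)] at key'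
  rw [Measure.map_apply (hR₁.prodMk hM₁) (hA.prod hB),
    Measure.map_apply (hR₂.prodMk hM₂) (hA.prod hB)]
  exact key'

theorem map_noise_eq [IsProbabilityMeasure P] (h : IsLocalFieldProcess ϖ F ν μ₀ γ P T X ξ Z) [IsProbabilityMeasure ν]
    (k : ℕ) :
    P.map (fun ω => ((treeHist T X k ω, maskedPhantom (T ω) fun v => Z k v ω),
        fun v => ξ v k ω)) =
      (P.map fun ω => (treeHist T X k ω, maskedPhantom (T ω) fun v => Z k v ω)).prod
        (Measure.infinitePi fun _ => ν) := by
  have hR := measurable_treeHist h.measurable_tree h.measurable_state k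
  have hM : Measurable fun ω => maskedPhantom (T ω) fun v => Z k v ω :=
    measurable_maskedPhantom.comp (h.measurable_tree.prodMk
      (measurable_pi_iff.2 (h.measurable_phantom k)))
  have hξ : Measurable fun ω v => ξ v k ω := measurable_pi_iff.2 fun v => h.measurable_noise v k
  have hind : IndepFun (fun ω => (treeHist T X k ω, maskedPhantom (T ω) fun v => Z k v ω))
      (fun ω v => ξ v k ω) P :=
    (h.noise_fresh k).comp (φ := fun p => (p.1, maskedPhantom p.1.1 p.2)) (ψ := id)
      (measurable_fst.prodMk (measurable_maskedPhantom.comp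
        (measurable_fst.fst.prodMk measurable_snd))) measurable_id
  rw [(indepFun_iff_map_prod_eq_prod_map_map (hR.prodMk hM).aemeasurable hξ.aemeasurable).1 hind,
    (h.noise_indep k).map_fun_eq_infinitePi_map fun v => h.measurable_noise v k]
  simp only [h.noise_law]

/-- Masking is harmless because a vertex outside the tree is sent to the cemetery without reading
its phantom particle. -/
theorem ae_treeHist_succ (h : IsLocalFieldProcess ϖ F ν μ₀ γ P T X ξ Z) (k : ℕ) :
    treeHist T X (k + 1) =ᵐ[P] fun ω => (T ω, fun v => extendHist (hist (X v) k ω)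
      (fieldStep ϖ F (treeHist T X k ω, maskedPhantom (T ω) fun v => Z k v ω)
        (fun v => ξ v k ω) v)) := by
  have h1 : ∀ v : Label2, ∀ᵐ ω ∂P, X v (k + 1) ω =
      fieldStep ϖ F (treeHist T X k ω, maskedPhantom (T ω) fun v => Z k v ω)
        (fun v => ξ v k ω) v := by
    intro v
    by_cases hv : v.1.length = 2
    · filter_upwards [h.step_outer ⟨v, hv⟩ k] with ω hω
      rw [hω, fieldStep]
      by_cases hT : v.1 ∈ T ω
      · simp [treeHist, maskedPhantom, hT, hv]
      · simp [treeHist, hT]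
    · filter_upwards [h.step_inner v k (by have := v.2; omega)] with ω hω
      rw [hω, fieldStep]
      by_cases hT : v.1 ∈ T ω
      · simp [treeHist, hT, hv, innerNbhd, nbrHist2]
      · simp [treeHist, hT]
  filter_upwards [ae_all_iff.2 h1] with ω hω
  refine Prod.ext rfl (funext fun v => ?_)
  simp only [← hω]
  exact hist_succ _ _ _

variable [SecondCountableTopology 𝓧] [BorelSpace 𝓧]

/-- The agreement of the kernels at time k is required only once the laws agree at time k, which is
the induction hypothesis; this is what (c) can supply. -/
theorem map_treeHist_eq (hF : MeasurableUpdate F)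
    (h₁ : IsLocalFieldProcess ϖ F ν μ₀ γ₁ P₁ T₁ X₁ ξ₁ Z₁)
    (h₂ : IsLocalFieldProcess ϖ F ν μ₀ γ₂ P₂ T₂ X₂ ξ₂ Z₂)
    (hγ : ∀ k, P₁.map (treeHist T₁ X₁ k) = P₂.map (treeHist T₂ X₂ k) →
      ∀ (v : SecondGen) (B : Set (UnorderedSeq (Fin (k + 1) → 𝓧))), MeasurableSet B →
      ∀ᵐ p ∂P₂.map (treeHist T₂ X₂ k), v.1.1 ∈ p.1 →
        γ₁ k (p.2 v.1, p.2 (parent2 v.1)) B = γ₂ k (p.2 v.1, p.2 (parent2 v.1)) B) (k : ℕ) :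
    P₁.map (treeHist T₁ X₁ k) = P₂.map (treeHist T₂ X₂ k) := by
  induction k with
  | zero =>
    have hφ : Measurable fun (p : Set Label × (Label2 → 𝓧)) =>
        (p.1, fun v (_ : Fin (0 + 1)) => p.2 v) := by fun_prop
    rw [treeHist_zero, treeHist_zero, ← Measure.map_map hφ, ← Measure.map_map hφ,
      h₁.init_law, h₂.init_law]
    · exact h₂.measurable_tree.prodMk (measurable_pi_iff.2 fun v => h₂.measurable_state v 0)
    · exact h₁.measurable_tree.prodMk (measurable_pi_iff.2 fun v => h₁.measurable_state v 0)
  | succ k ih =>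
    have hν : IsProbabilityMeasure ν := by
      rw [← h₁.noise_law root2 0]
      exact Measure.isProbabilityMeasure_map (h₁.measurable_noise _ _).aemeasurable
    let Ψ : ((Set Label × (Label2 → Fin (k + 1) → 𝓧)) ×
        (SecondGen → UnorderedSeq (Fin (k + 1) → 𝓧))) × (Label2 → Ξ) →
        Set Label × (Label2 → Fin (k + 1 + 1) → 𝓧) := fun q =>
      (q.1.1.1, fun v => extendHist (q.1.1.2 v) (fieldStep ϖ F q.1 q.2 v))
    have hΨ : Measurable Ψ := measurable_fst.fst.fst.prodMk (measurable_pi_iff.2 fun v =>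
      measurable_extendHist.comp (Measurable.prodMk (by fun_prop)
        (measurable_pi_iff.1 (measurable_fieldStep hF) v)))
    have hJ := h₁.map_maskedPhantom_eq h₂ ih (hγ k ih)
    have hm₁ : Measurable fun ω => ((treeHist T₁ X₁ k ω, maskedPhantom (T₁ ω) fun v => Z₁ k v ω),
        fun v => ξ₁ v k ω) :=
      ((measurable_treeHist h₁.measurable_tree h₁.measurable_state k).prodMk
        (measurable_maskedPhantom.comp (h₁.measurable_tree.prodMk
          (measurable_pi_iff.2 (h₁.measurable_phantom k))))).prodMk
        (measurable_pi_iff.2 fun v => h₁.measurable_noise v k)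
    have hm₂ : Measurable fun ω => ((treeHist T₂ X₂ k ω, maskedPhantom (T₂ ω) fun v => Z₂ k v ω),
        fun v => ξ₂ v k ω) :=
      ((measurable_treeHist h₂.measurable_tree h₂.measurable_state k).prodMk
        (measurable_maskedPhantom.comp (h₂.measurable_tree.prodMk
          (measurable_pi_iff.2 (h₂.measurable_phantom k))))).prodMk
        (measurable_pi_iff.2 fun v => h₂.measurable_noise v k)
    -- With the product noise adjoined, everything that enters the step has the same law for both
    -- processes, and both apply the same map `Ψ`.
    have hL := (h₁.map_noise_eq k).trans ((congrArg (fun m => Measure.prod m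
      (Measure.infinitePi fun _ => ν)) hJ).trans (h₂.map_noise_eq k).symm)
    have := congrArg (Measure.map Ψ) hL
    rw [Measure.map_map hΨ hm₁, Measure.map_map hΨ hm₂] at this
    rw [Measure.map_congr (h₁.ae_treeHist_succ k), Measure.map_congr (h₂.ae_treeHist_succ k)]
    exact this

/-- A local-field process is determined in law by its initial law, if the kernels agree where they
are evaluated. -/
theorem trajLaw2_eq (hF : MeasurableUpdate F)
    (h₁ : IsLocalFieldProcess ϖ F ν μ₀ γ₁ P₁ T₁ X₁ ξ₁ Z₁)
    (h₂ : IsLocalFieldProcess ϖ F ν μ₀ γ₂ P₂ T₂ X₂ ξ₂ Z₂)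
    (hγ : ∀ k, P₁.map (treeHist T₁ X₁ k) = P₂.map (treeHist T₂ X₂ k) →
      ∀ (v : SecondGen) (B : Set (UnorderedSeq (Fin (k + 1) → 𝓧))), MeasurableSet B →
      ∀ᵐ p ∂P₂.map (treeHist T₂ X₂ k), v.1.1 ∈ p.1 →
        γ₁ k (p.2 v.1, p.2 (parent2 v.1)) B = γ₂ k (p.2 v.1, p.2 (parent2 v.1)) B) :
    trajLaw2 P₁ T₁ X₁ = trajLaw2 P₂ T₂ X₂ := by
  have hk := map_treeHist_eq hF h₁ h₂ hγ
  have hm₁ : Measurable fun ω (k : ℕ) => (T₁ ω, fun v => X₁ v k ω) :=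
    measurable_pi_iff.2 fun k => h₁.measurable_tree.prodMk
      (measurable_pi_iff.2 fun v => h₁.measurable_state v k)
  have hm₂ : Measurable fun ω (k : ℕ) => (T₂ ω, fun v => X₂ v k ω) :=
    measurable_pi_iff.2 fun k => h₂.measurable_tree.prodMk
      (measurable_pi_iff.2 fun v => h₂.measurable_state v k)
  have key : P₁.map (fun ω (k : ℕ) => (T₁ ω, fun v => X₁ v k ω)) =
      P₂.map (fun ω (k : ℕ) => (T₂ ω, fun v => X₂ v k ω)) := by
    -- Trajectory laws are projective limits of their finite-dimensional marginals, and any finite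
    -- set of times lies within a history up to some `n`.
    have e₁ := isProjectiveLimit_map (P := P₁) (X := fun (k : ℕ) ω => (T₁ ω, fun v => X₁ v k ω))
      hm₁.aemeasurable
    have e₂ := isProjectiveLimit_map (P := P₂) (X := fun (k : ℕ) ω => (T₂ ω, fun v => X₂ v k ω))
      hm₂.aemeasurable
    refine e₁.unique (fun I => (e₂ I).trans ?_)
    obtain ⟨n, hn⟩ : ∃ n, ∀ i ∈ I, i < n + 1 :=
      ⟨I.sup id, fun i hi => Nat.lt_succ_of_le (Finset.le_sup (f := id) hi)⟩
    let φ : Set Label × (Label2 → Fin (n + 1) → 𝓧) → I → Set Label × (Label2 → 𝓧) :=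
      fun p i => (p.1, fun v => p.2 v ⟨i.1, hn i.1 i.2⟩)
    have hφ : Measurable φ := by fun_prop
    have h3 := congrArg (Measure.map φ) (hk n)
    rw [Measure.map_map hφ (measurable_treeHist h₁.measurable_tree h₁.measurable_state n),
      Measure.map_map hφ (measurable_treeHist h₂.measurable_tree h₂.measurable_state n)] at h3
    exact h3.symm
  let g : (ℕ → Set Label × (Label2 → 𝓧)) → Label2 → Prop × (ℕ → 𝓧) :=
    fun y v => (v.1 ∈ (y 0).1, fun k => (y k).2 v)
  have hg : Measurable g := measurable_pi_iff.2 fun v =>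
    ((measurable_set_mem v.1).comp (measurable_pi_apply 0).fst).prodMk (by fun_prop)
  have h3 := congrArg (Measure.map g) key
  rw [Measure.map_map hg hm₁, Measure.map_map hg hm₂] at h3
  exact h3

end IsLocalFieldProcess

end Uniqueness

/-! ### Agreement of the kernels of two local-field processes -/

section Comparison

variable {Ω₁ Ω₂ 𝓧 Ξ : Type*} [MeasurableSpace Ω₁] [MeasurableSpace Ω₂] [MeasurableSpace 𝓧]
  [MeasurableSpace Ξ] [TopologicalSpace 𝓧]
  {ϖ : 𝓧} {F : Update 𝓧 Ξ} {ν : Measure Ξ} {μ₀ : Measure (Set Label × (Label2 → 𝓧))}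
  {γ₁ γ₂ : ∀ k : ℕ, Kernel ((Fin (k + 1) → 𝓧) × (Fin (k + 1) → 𝓧))
    (UnorderedSeq (Fin (k + 1) → 𝓧))}
  {P₁ : Measure Ω₁} {T₁ : Ω₁ → Set Label} {X₁ : Label2 → ℕ → Ω₁ → 𝓧}
  {ξ₁ : Label2 → ℕ → Ω₁ → Ξ} {Z₁ : ∀ k : ℕ, SecondGen → Ω₁ → UnorderedSeq (Fin (k + 1) → 𝓧)}
  {P₂ : Measure Ω₂} {T₂ : Ω₂ → Set Label} {X₂ : Label2 → ℕ → Ω₂ → 𝓧}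
  {ξ₂ : Label2 → ℕ → Ω₂ → Ξ} {Z₂ : ∀ k : ℕ, SecondGen → Ω₂ → UnorderedSeq (Fin (k + 1) → 𝓧)}

/-- If the law of the histories up to time `k` is the same for two local-field processes, then the
kernel of the first one is also a version of the conditional law for the second one. -/
theorem IsLocalFieldProcess.kernel_spec_of_map_eq [SecondCountableTopology 𝓧] [BorelSpace 𝓧]
    (h₁ : IsLocalFieldProcess ϖ F ν μ₀ γ₁ P₁ T₁ X₁ ξ₁ Z₁)
    (h₂ : IsLocalFieldProcess ϖ F ν μ₀ γ₂ P₂ T₂ X₂ ξ₂ Z₂) {k : ℕ}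
    (hk : P₁.map (treeHist T₁ X₁ k) = P₂.map (treeHist T₂ X₂ k)) :
    IsCondLaw P₂ (fun ω => (hist (X₂ one2) k ω, hist (X₂ root2) k ω))
      (nbrHist2 T₂ X₂ one2 k) (γ₁ k) := by
  have hR₁ := measurable_treeHist h₁.measurable_tree h₁.measurable_state k
  have hR₂ := measurable_treeHist h₂.measurable_tree h₂.measurable_state k
  have he : Measurable fun p : Set Label × (Label2 → Fin (k + 1) → 𝓧) =>
    (p.2 one2, p.2 root2) := by fun_prop
  have h := h₁.kernel_spec k
  refine ⟨h.1, ?_⟩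
  have hW := congrArg (Measure.map fun p => (p.2 one2, p.2 root2)) hk
  have hJ := congrArg
    (Measure.map fun p => ((p.2 one2, p.2 root2), innerNbhd (𝓧 := 𝓧) one2 p)) hk
  rw [Measure.map_map he hR₁, Measure.map_map he hR₂] at hW
  rw [Measure.map_map (he.prodMk (measurable_innerNbhd one2)) hR₁,
    Measure.map_map (he.prodMk (measurable_innerNbhd one2)) hR₂] at hJ
  exact (congrArg (fun m => m ⊗ₘ γ₁ k) hW.symm).trans (h.2.trans hJ)

/-- If the second process does not depend on the choice of the versions, then the kernels of two
local-field processes agree where the second process evaluates them. -/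
theorem IsLocalFieldProcess.ae_kernel_eq [IsProbabilityMeasure P₂]
    [SecondCountableTopology 𝓧] [BorelSpace 𝓧]
    (h₁ : IsLocalFieldProcess ϖ F ν μ₀ γ₁ P₁ T₁ X₁ ξ₁ Z₁)
    (h₂ : IsLocalFieldProcess ϖ F ν μ₀ γ₂ P₂ T₂ X₂ ξ₂ Z₂) (hac : Unambiguous P₂ T₂ X₂) {k : ℕ}
    (hk : P₁.map (treeHist T₁ X₁ k) = P₂.map (treeHist T₂ X₂ k)) (v : SecondGen)
    {B : Set (UnorderedSeq (Fin (k + 1) → 𝓧))} (hB : MeasurableSet B) :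
    ∀ᵐ p ∂P₂.map (treeHist T₂ X₂ k), v.1.1 ∈ p.1 →
      γ₁ k (p.2 v.1, p.2 (parent2 v.1)) B = γ₂ k (p.2 v.1, p.2 (parent2 v.1)) B := by
  have hR₂ := measurable_treeHist h₂.measurable_tree h₂.measurable_state k
  have hW : Measurable fun ω => (hist (X₂ v.1) k ω, hist (X₂ (parent2 v.1)) k ω) :=
    (by fun_prop : Measurable fun p : Set Label × (Label2 → Fin (k + 1) → 𝓧) =>
      (p.2 v.1, p.2 (parent2 v.1))).comp hR₂
  -- Both kernels are versions for the second process at the base edge; absolute continuity then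
  -- transfers their agreement to the edge of v on the event that v is in the tree.
  have heq := (h₁.kernel_spec_of_map_eq h₂ hk).ae_apply_eq (h₂.kernel_spec k) hB
  have hv := ae_of_ae_map hW.aemeasurable ((hac k v.1 v.2).ae_le heq)
  have hmem : MeasurableSet {ω | v.1.1 ∈ T₂ ω} := measurableSet_setOfPred.2
    ((measurable_set_mem v.1.1).comp h₂.measurable_tree)
  rw [ae_restrict_iff' hmem] at hv
  have hm : Measurable fun p : Set Label × (Label2 → Fin (k + 1) → 𝓧) =>
    (p.2 v.1, p.2 (parent2 v.1)) := by fun_prop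
  have hset : MeasurableSet {p : Set Label × (Label2 → Fin (k + 1) → 𝓧) | v.1.1 ∈ p.1 →
      γ₁ k (p.2 v.1, p.2 (parent2 v.1)) B = γ₂ k (p.2 v.1, p.2 (parent2 v.1)) B} :=
    measurableSet_setOfPred.2 (((measurable_set_mem v.1.1).comp measurable_fst).imp
      (measurableSet_setOfPred.1 (measurableSet_eq_fun ((Kernel.measurable_coe _ hB).comp hm)
        ((Kernel.measurable_coe _ hB).comp hm))))
  exact (ae_map_iff hR₂.aemeasurable hset).2 hv

end Comparison

theorem trajLaw2_inter_firstTwoGenerations {Ω 𝓧 : Type*} [MeasurableSpace Ω] [MeasurableSpace 𝓧]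
    (μ : Measure Ω) (T : Ω → Set Label) (X : Label2 → ℕ → Ω → 𝓧) :
    trajLaw2 μ (fun ω => T ω ∩ firstTwoGenerations) X = trajLaw2 μ T X := by
  have h : ∀ (ω : Ω) (v : Label2), (v.1 ∈ T ω ∩ firstTwoGenerations) = (v.1 ∈ T ω) :=
    fun ω v => propext ⟨fun h => h.1, fun h => ⟨h, v.2⟩⟩
  simp only [trajLaw2, h]

end LocalField

/-! ### The main theorem -/

theorem theorem2p7
    {𝓧 : Type*} [TopologicalSpace 𝓧] [PolishSpace 𝓧] [MeasurableSpace 𝓧] [BorelSpace 𝓧]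
    {Ξ : Type*} [TopologicalSpace Ξ] [PolishSpace Ξ] [MeasurableSpace Ξ] [BorelSpace Ξ]
    {Ω : Type u} [MeasurableSpace Ω] (μ : Measure Ω) [IsProbabilityMeasure μ]
    (ρ₀ ρ : Measure ℕ) [IsProbabilityMeasure ρ₀] [IsProbabilityMeasure ρ]
    (ϖ : 𝓧) (hϖ : IsOpen ({ϖ} : Set 𝓧))
    (F : LocalField.Update 𝓧 Ξ) (ν : Measure Ξ)
    (T : Ω → Set LocalField.Label) (X : LocalField.Label → ℕ → Ω → 𝓧)
    (ξ : LocalField.Label → ℕ → Ω → Ξ)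
    (hA : LocalField.GWAssumptions ρ₀ ρ ϖ F ν μ T X ξ)
    (hX : LocalField.GWDynamics ϖ F μ T X ξ) :
    -- The local-field equation is well posed whenever its conditional laws are given by versions
    -- that do not depend on the base edge. Such versions exist, and with any of them local-field
    -- processes exist and all have the asserted law.
    (∃ γ, LocalField.IsHomogeneousVersion μ T X γ) ∧
    (∀ γ, LocalField.IsHomogeneousVersion μ T X γ →
      (∃ (Ω' : Type u) (_ : MeasurableSpace Ω') (P : Measure Ω') (_ : IsProbabilityMeasure P)
        (T' : Ω' → Set LocalField.Label) (X' : LocalField.Label2 → ℕ → Ω' → 𝓧)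
        (ξ' : LocalField.Label2 → ℕ → Ω' → Ξ)
        (Z : ∀ k : ℕ, {v : LocalField.Label2 // v.1.length = 2} → Ω' →
          LocalField.UnorderedSeq (Fin (k + 1) → 𝓧)),
        LocalField.IsLocalFieldProcess ϖ F ν (LocalField.initLaw2 μ T X) γ P T' X' ξ' Z) ∧
      ∀ (Ω' : Type w) (_ : MeasurableSpace Ω') (P : Measure Ω') (_ : IsProbabilityMeasure P)
        (T' : Ω' → Set LocalField.Label) (X' : LocalField.Label2 → ℕ → Ω' → 𝓧)
        (ξ' : LocalField.Label2 → ℕ → Ω' → Ξ)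
        (Z : ∀ k : ℕ, {v : LocalField.Label2 // v.1.length = 2} → Ω' →
          LocalField.UnorderedSeq (Fin (k + 1) → 𝓧)),
        LocalField.IsLocalFieldProcess ϖ F ν (LocalField.initLaw2 μ T X) γ P T' X' ξ' Z →
        LocalField.trajLaw2 μ T (fun v => X v.1) = LocalField.trajLaw2 P T' X') ∧
    -- With arbitrary versions `γ` of the conditional laws, every local-field process for which
    -- the equation does not depend on the choice of the versions has the asserted law.
    (∀ (γ : ∀ k : ℕ, Kernel ((Fin (k + 1) → 𝓧) × (Fin (k + 1) → 𝓧))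
          (LocalField.UnorderedSeq (Fin (k + 1) → 𝓧)))
        (Ω' : Type w) (_ : MeasurableSpace Ω') (P : Measure Ω') (_ : IsProbabilityMeasure P)
        (T' : Ω' → Set LocalField.Label) (X' : LocalField.Label2 → ℕ → Ω' → 𝓧)
        (ξ' : LocalField.Label2 → ℕ → Ω' → Ξ)
        (Z : ∀ k : ℕ, {v : LocalField.Label2 // v.1.length = 2} → Ω' →
          LocalField.UnorderedSeq (Fin (k + 1) → 𝓧)),
        LocalField.IsLocalFieldProcess ϖ F ν (LocalField.initLaw2 μ T X) γ P T' X' ξ' Z →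
        LocalField.Unambiguous P T' X' →
        LocalField.trajLaw2 μ T (fun v => X v.1) = LocalField.trajLaw2 P T' X') := by
  have hF := hA.measurable_update
  refine ⟨hX.exists_isHomogeneousVersion hA, fun γ hγ => ⟨?_, ?_⟩, ?_⟩
  -- The restricted particle system itself is the required process.
  · exact ⟨Ω, _, μ, inferInstance, _, _, _, _, hX.isLocalFieldProcess hA hγ⟩
  · intro Ω' _ P _ T' X' ξ' Z h
    rw [← LocalField.trajLaw2_inter_firstTwoGenerations]
    -- Both processes use the same `γ`, so the kernels agree everywhere.
    exact (hX.isLocalFieldProcess hA hγ).trajLaw2_eq hF h fun k _ v B _ => ae_of_all _ fun _ _ => rfl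
  · intro γ Ω' _ P _ T' X' ξ' Z h hac
    -- The given kernels need not be versions for every edge; the comparison is with the particle
    -- system run with a homogeneous version `γ₀`.
    obtain ⟨γ₀, hγ₀⟩ := hX.exists_isHomogeneousVersion hA
    have h₀ := hX.isLocalFieldProcess hA hγ₀
    rw [← LocalField.trajLaw2_inter_firstTwoGenerations]
    exact h₀.trajLaw2_eq hF h fun k hk v B hB => h₀.ae_kernel_eq h hac hk v hB
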